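/- Let $C=\sum_{i=1}^m C_i$ be a cost function on $\{0,1\}^n$ with real-valued terms $C_i$, each depending on at most two variables. Its interaction graph is the simple graph on $[n]$ in which distinct $j,k$ are adjacent iff some $C_i$ depends nontrivially on both $x_j$ and $x_k$ (flipping either bit can change the value of $C_i$). Let $\gamma,\beta\in\mathbb{R}^p$, let $B=\sum_{j=1}^n X_j$, and let $Q$ be the depth-$p$ QAOA circuit that prepares $$|\gamma,\beta\rangle = e^{-i\beta_p B}e^{-i\gamma_p C}\cdots e^{-i\beta_1 B}e^{-i\gamma_1 C}|+\rangle^{\otimes n},$$ which is then measured in the computational basis with outcome $Z\in\{0,1\}^n$. The circuit is given, up to a global phase, by the interaction graph and the matrix entries of its gates: in each layer, one diagonal two-qubit gate per edge of the interaction graph, one diagonal one-qubit gate per qubit, and the one-qubit gate $e^{-i\beta_l X}$. There is a deterministic algorithm (a single program of an arithmetic random-access machine, with unit cost for the operations $+,-,\times$ and complex conjugation on complex numbers, and logarithmic cost for the operations on natural numbers used for control and addressing) with the following property. For all $n,p\ge 1$, every such circuit $Q$ whose interaction graph has maximum degree at most $2$, every $S\subseteq[n]$ and every $z_S\in\{0,1\}^S$,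 the algorithm, given $Q$, $S$ and $z_S$, computes the marginal probability $\Pr[Z_S=z_S]$ exactly in time $(np)^{O(1)}\exp(O(p))$, where the constants in the $O(\cdot)$ are absolute. -/

import Mathlib

namespace QAOASim

/-! ## QAOA with two-local cost functions -/

/-- The bit string `x` with its `j`-th bit flipped. -/
def flipBit {n : ℕ} (j : Fin n) (x : Fin n → Fin 2) : Fin n → Fin 2 :=
  Function.update x j (x j + 1)

open Classical in
/-- The variables on which `f` depends nontrivially: flipping that bit can change the value. -/
noncomputable def relevantVars {n : ℕ} (f : (Fin n → Fin 2) → ℝ) : Finset (Fin n) :=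
  Finset.univ.filter fun j => ∃ x, f (flipBit j x) ≠ f x

/-- A depth-`p` QAOA instance on `n` qubits: a cost function with a decomposition into terms that
each depend on at most two variables, and the angles of the `p` layers. -/
structure Instance (n p : ℕ) where
  /-- number of terms of the decomposition -/
  numTerms : ℕ
  /-- the terms -/
  term : Fin numTerms → (Fin n → Fin 2) → ℝ
  two_local : ∀ i, (relevantVars (term i)).card ≤ 2
  /-- phase angles -/
  γ : Fin p → ℝ
  /-- mixing angles -/
  β : Fin p → ℝ

namespace Instance

variable {n p : ℕ} (Q : Instance n p)

/-- The cost function, the sum of all terms. -/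
noncomputable def cost (x : Fin n → Fin 2) : ℝ := ∑ i, Q.term i x

/-- The interaction graph of the decomposition. -/
def interactionGraph : SimpleGraph (Fin n) where
  Adj j k := j ≠ k ∧ ∃ i, j ∈ relevantVars (Q.term i) ∧ k ∈ relevantVars (Q.term i)
  symm := ⟨fun _ _ ⟨h, i, hj, hk⟩ => ⟨h.symm, i, hk, hj⟩⟩
  loopless := ⟨fun _ h => h.1 rfl⟩

open Classical in
/-- The maximum vertex degree of the interaction graph. -/
noncomputable def interactionDegree : ℕ := Q.interactionGraph.maxDegree

/-- The Pauli matrix `X`. -/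
def pauliX : Matrix (Fin 2) (Fin 2) ℂ := !![0, 1; 1, 0]

/-- `X` acting on qubit `j` of `n` qubits: `X_j |y⟩ = |y with bit j flipped⟩`. -/
def pauliXAt (j : Fin n) : Matrix (Fin n → Fin 2) (Fin n → Fin 2) ℂ :=
  Matrix.of fun x y => if x = flipBit j y then 1 else 0

/-- The mixing operator `B = ∑ j, X_j`. -/
def mixing (n : ℕ) : Matrix (Fin n → Fin 2) (Fin n → Fin 2) ℂ := ∑ j, pauliXAt j

/-- The cost function as a diagonal operator. -/
noncomputable def costOp : Matrix (Fin n → Fin 2) (Fin n → Fin 2) ℂ :=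
  Matrix.diagonal fun x => (Q.cost x : ℂ)

/-- `exp (-i γ_l C)`. -/
noncomputable def phaseLayer (l : Fin p) : Matrix (Fin n → Fin 2) (Fin n → Fin 2) ℂ :=
  NormedSpace.exp ((-(Complex.I * (Q.γ l : ℂ))) • Q.costOp)

/-- `exp (-i β_l B)`. -/
noncomputable def mixLayer (l : Fin p) : Matrix (Fin n → Fin 2) (Fin n → Fin 2) ℂ :=
  NormedSpace.exp ((-(Complex.I * (Q.β l : ℂ))) • mixing n)

/-- The state `|+⟩` on all `n` qubits. -/
noncomputable def plusState (n : ℕ) : (Fin n → Fin 2) → ℂ :=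
  fun _ => ∏ _j : Fin n, (1 / (Real.sqrt 2 : ℂ))

/-- The output state: the layers `l = 0, …, p - 1` are applied in this order to `|+⟩`, in each
layer first `exp (-i γ_l C)` and then `exp (-i β_l B)`. -/
noncomputable def outputState : (Fin n → Fin 2) → ℂ :=
  Fin.foldl p (fun ψ l => (Q.mixLayer l).mulVec ((Q.phaseLayer l).mulVec ψ)) (plusState n)

/-- `Pr[Z_S = z_S]` for the measurement of the output state in the computational basis. -/
noncomputable def marginal (S : Finset (Fin n)) (z : S → Fin 2) : ℝ :=
  ∑ x : Fin n → Fin 2 with ∀ j : S, x j = z j, ‖Q.outputState x‖ ^ 2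

/-! ### The gates of the circuit

Every phase layer consists of one diagonal gate per qubit and one diagonal gate per edge of the
interaction graph (constant terms of the cost function only give a global phase), every mixing
layer of one gate per qubit. -/

/-- Total value, when `x j = a`, of the terms that depend on exactly the variable `j`. -/
noncomputable def vertexCost (j : Fin n) (a : Fin 2) : ℝ :=
  ∑ i with relevantVars (Q.term i) = {j}, Q.term i (Function.update 0 j a)

/-- Total value, when `x j = a` and `x k = b`, of the terms that depend on exactly the variables
`j` and `k`. -/
noncomputable def edgeCost (j k : Fin n) (a b : Fin 2) : ℝ :=
  ∑ i with relevantVars (Q.term i) = {j, k},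
    Q.term i (Function.update (Function.update 0 j a) k b)

/-- Diagonal entry `a` of the phase gate on qubit `j` in layer `l`. -/
noncomputable def vertexGate (l : Fin p) (j : Fin n) (a : Fin 2) : ℂ :=
  Complex.exp (-(Complex.I * (Q.γ l : ℂ)) * (Q.vertexCost j a : ℂ))

/-- Diagonal entry `(a, b)` of the phase gate on the qubits `j`, `k` in layer `l`. -/
noncomputable def edgeGate (l : Fin p) (j k : Fin n) (a b : Fin 2) : ℂ :=
  Complex.exp (-(Complex.I * (Q.γ l : ℂ)) * (Q.edgeCost j k a b : ℂ))

/-- The mixing gate `exp (-i β_l X)`, the same for every qubit. -/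
noncomputable def mixGate (l : Fin p) : Matrix (Fin 2) (Fin 2) ℂ :=
  NormedSpace.exp ((-(Complex.I * (Q.β l : ℂ))) • pauliX)

end Instance

/-! ## A deterministic arithmetic random-access machine

The memory holds natural numbers (for control and addressing) and complex numbers. Operations on
natural numbers are charged by the bit lengths of the numbers involved (logarithmic cost);
arithmetic operations on complex numbers have unit cost. A program cannot test complex numbers. -/

/-- Memory: natural-number variables, arrays of natural numbers, arrays of complex numbers. -/
structure Memory where
  /-- `var x` is the value of variable number `x` -/
  var : ℕ → ℕ
  /-- `arr A i` is cell `i` of natural-number array number `A` -/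
  arr : ℕ → ℕ → ℕ
  /-- `num A i` is cell `i` of complex array number `A` -/
  num : ℕ → ℕ → ℂ

/-- Natural-number expressions. -/
inductive NExp
  | const (c : ℕ)
  | var (x : ℕ)
  | load (A : ℕ) (i : NExp)
  | add (a b : NExp)
  | sub (a b : NExp)
  | mul (a b : NExp)
  | div (a b : NExp)
  | mod (a b : NExp)

/-- Value (subtraction is truncated, division rounds down). -/
def NExp.eval (s : Memory) : NExp → ℕ
  | .const c => c
  | .var x => s.var x
  | .load A i => s.arr A (i.eval s)
  | .add a b => a.eval s + b.eval s
  | .sub a b => a.eval s - b.eval s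
  | .mul a b => a.eval s * b.eval s
  | .div a b => a.eval s / b.eval s
  | .mod a b => a.eval s % b.eval s

/-- Cost of evaluating; `Nat.size` is the bit length. -/
def NExp.cost (s : Memory) : NExp → ℕ
  | .const c => 1 + Nat.size c
  | .var x => 1 + Nat.size (s.var x)
  | .load A i => i.cost s + 1 + Nat.size (i.eval s) + Nat.size (s.arr A (i.eval s))
  | .add a b => a.cost s + b.cost s + 1 + Nat.size (a.eval s) + Nat.size (b.eval s)
  | .sub a b => a.cost s + b.cost s + 1 + Nat.size (a.eval s) + Nat.size (b.eval s)
  | .mul a b => a.cost s + b.cost s + 1 + Nat.size (a.eval s) + Nat.size (b.eval s)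
  | .div a b => a.cost s + b.cost s + 1 + Nat.size (a.eval s) + Nat.size (b.eval s)
  | .mod a b => a.cost s + b.cost s + 1 + Nat.size (a.eval s) + Nat.size (b.eval s)

/-- Complex expressions. -/
inductive CExp
  | const (q : ℚ)
  | load (A : ℕ) (i : NExp)
  | add (a b : CExp)
  | sub (a b : CExp)
  | mul (a b : CExp)
  | conj (a : CExp)

/-- Value. -/
noncomputable def CExp.eval (s : Memory) : CExp → ℂ
  | .const q => (q : ℂ)
  | .load A i => s.num A (i.eval s)
  | .add a b => a.eval s + b.eval s
  | .sub a b => a.eval s - b.eval s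
  | .mul a b => a.eval s * b.eval s
  | .conj a => (starRingEnd ℂ) (a.eval s)

/-- Cost of evaluating: one per operation, plus the cost of computing addresses. -/
def CExp.cost (s : Memory) : CExp → ℕ
  | .const _ => 1
  | .load _ i => i.cost s + 1 + Nat.size (i.eval s)
  | .add a b => a.cost s + b.cost s + 1
  | .sub a b => a.cost s + b.cost s + 1
  | .mul a b => a.cost s + b.cost s + 1
  | .conj a => a.cost s + 1

/-- Programs. -/
inductive Prog
  | skip
  /-- `var x := e` -/
  | setVar (x : ℕ) (e : NExp)
  /-- `arr A [i] := e` -/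
  | setArr (A : ℕ) (i e : NExp)
  /-- `num A [i] := c` -/
  | setNum (A : ℕ) (i : NExp) (c : CExp)
  | seq (P P' : Prog)
  /-- `if a < b then P else P'` -/
  | ifLt (a b : NExp) (P P' : Prog)
  /-- `while a < b do P` -/
  | whileLt (a b : NExp) (P : Prog)

/-- Cost of the test `a < b`. -/
def testCost (s : Memory) (a b : NExp) : ℕ :=
  a.cost s + b.cost s + 1 + Nat.size (a.eval s) + Nat.size (b.eval s)

/-- `Run P s t s'`: the program `P`, started in memory `s`, halts with memory `s'` at cost `t`. -/
inductive Run : Prog → Memory → ℕ → Memory → Prop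
  | skip (s : Memory) : Run .skip s 1 s
  | setVar (x : ℕ) (e : NExp) (s : Memory) :
      Run (.setVar x e) s (e.cost s + 1 + Nat.size (e.eval s))
        { s with var := Function.update s.var x (e.eval s) }
  | setArr (A : ℕ) (i e : NExp) (s : Memory) :
      Run (.setArr A i e) s
        (i.cost s + e.cost s + 1 + Nat.size (i.eval s) + Nat.size (e.eval s))
        { s with arr := Function.update s.arr A
                          (Function.update (s.arr A) (i.eval s) (e.eval s)) }
  | setNum (A : ℕ) (i : NExp) (c : CExp) (s : Memory) :
      Run (.setNum A i c) s (i.cost s + c.cost s + 1 + Nat.size (i.eval s))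
        { s with num := Function.update s.num A
                          (Function.update (s.num A) (i.eval s) (c.eval s)) }
  | seq {P P' : Prog} {s s₁ s₂ : Memory} {t₁ t₂ : ℕ} :
      Run P s t₁ s₁ → Run P' s₁ t₂ s₂ → Run (.seq P P') s (t₁ + t₂) s₂
  | ifTrue {a b : NExp} {P P' : Prog} {s s' : Memory} {t : ℕ} :
      a.eval s < b.eval s → Run P s t s' → Run (.ifLt a b P P') s (testCost s a b + t) s'
  | ifFalse {a b : NExp} {P P' : Prog} {s s' : Memory} {t : ℕ} :
      ¬ a.eval s < b.eval s → Run P' s t s' → Run (.ifLt a b P P') s (testCost s a b + t) s'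
  | whileTrue {a b : NExp} {P : Prog} {s s₁ s₂ : Memory} {t₁ t₂ : ℕ} :
      a.eval s < b.eval s → Run P s t₁ s₁ → Run (.whileLt a b P) s₁ t₂ s₂ →
        Run (.whileLt a b P) s (testCost s a b + t₁ + t₂) s₂
  | whileFalse {a b : NExp} {P : Prog} {s : Memory} :
      ¬ a.eval s < b.eval s → Run (.whileLt a b P) s (testCost s a b) s

/-- The machine is deterministic: final memory and cost are determined by program and start. -/
theorem Run.deterministic {P : Prog} {s s₁ s₂ : Memory} {t₁ t₂ : ℕ}
    (h₁ : Run P s t₁ s₁) (h₂ : Run P s t₂ s₂) : t₁ = t₂ ∧ s₁ = s₂ := by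
  induction h₁ generalizing t₂ s₂ with
  | skip | setVar | setArr | setNum => cases h₂; exact ⟨rfl, rfl⟩
  | seq _ _ ih ih' =>
    cases h₂ with
    | seq g g' =>
      obtain ⟨rfl, rfl⟩ := ih g
      obtain ⟨rfl, rfl⟩ := ih' g'
      exact ⟨rfl, rfl⟩
  | ifTrue hc _ ih =>
    cases h₂ with
    | ifTrue _ g => obtain ⟨rfl, rfl⟩ := ih g; exact ⟨rfl, rfl⟩
    | ifFalse hn _ => exact absurd hc hn
  | ifFalse hc _ ih =>
    cases h₂ with
    | ifTrue hn _ => exact absurd hn hc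
    | ifFalse _ g => obtain ⟨rfl, rfl⟩ := ih g; exact ⟨rfl, rfl⟩
  | whileTrue hc _ _ ih ih' =>
    cases h₂ with
    | whileTrue _ g g' =>
      obtain ⟨rfl, rfl⟩ := ih g
      obtain ⟨rfl, rfl⟩ := ih' g'
      exact ⟨rfl, rfl⟩
    | whileFalse hn => exact absurd hc hn
  | whileFalse hc =>
    cases h₂ with
    | whileTrue hn _ _ => exact absurd hn hc
    | whileFalse _ => exact ⟨rfl, rfl⟩

/-! ## Input and output

All addresses below are injective in the indices, and every cell that is not mentioned is `0`. -/

/-- The natural-number `0`-`1` table of the interaction graph: cell `j * n + k`. -/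
noncomputable def graphArray {n p : ℕ} (Q : Instance n p) : ℕ → ℕ :=
  open Classical in
  Function.extend (fun (q : Fin n × Fin n) => (q.1 : ℕ) * n + q.2)
    (fun q => if Q.interactionGraph.Adj q.1 q.2 then 1 else 0) 0

/-- The requested event: cell `j` is `0` if `j ∉ S`, and `1 + z j` if `j ∈ S`. -/
noncomputable def eventArray {n : ℕ} (S : Finset (Fin n)) (z : S → Fin 2) : ℕ → ℕ :=
  Function.extend (fun j : Fin n => (j : ℕ))
    (fun j => if h : j ∈ S then 1 + (z ⟨j, h⟩ : ℕ) else 0) 0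

/-- The entries of the mixing gates: cell `(l * 2 + a) * 2 + b`. -/
noncomputable def mixArray {n p : ℕ} (Q : Instance n p) : ℕ → ℂ :=
  Function.extend (fun (q : Fin p × Fin 2 × Fin 2) => ((q.1 : ℕ) * 2 + q.2.1) * 2 + q.2.2)
    (fun q => Q.mixGate q.1 q.2.1 q.2.2) 0

/-- The diagonal entries of the one-qubit phase gates: cell `(l * n + j) * 2 + a`. -/
noncomputable def vertexArray {n p : ℕ} (Q : Instance n p) : ℕ → ℂ :=
  Function.extend (fun (q : Fin p × Fin n × Fin 2) => ((q.1 : ℕ) * n + q.2.1) * 2 + q.2.2)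
    (fun q => Q.vertexGate q.1 q.2.1 q.2.2) 0

/-- The diagonal entries of the two-qubit phase gates: cell `(((l * n + j) * n + k) * 2 + a) * 2 + b`
if `j` and `k` are adjacent in the interaction graph. -/
noncomputable def edgeArray {n p : ℕ} (Q : Instance n p) : ℕ → ℂ :=
  open Classical in
  Function.extend
    (fun (q : Fin p × Fin n × Fin n × Fin 2 × Fin 2) =>
      ((((q.1 : ℕ) * n + q.2.1) * n + q.2.2.1) * 2 + q.2.2.2.1) * 2 + q.2.2.2.2)
    (fun q => if Q.interactionGraph.Adj q.2.1 q.2.2.1 then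
      Q.edgeGate q.1 q.2.1 q.2.2.1 q.2.2.2.1 q.2.2.2.2 else 0) 0

/-- The start memory: the gates of the circuit and the requested event. -/
noncomputable def inputMemory {n p : ℕ} (Q : Instance n p) (S : Finset (Fin n)) (z : S → Fin 2) :
    Memory where
  var
    | 0 => n
    | 1 => p
    | _ => 0
  arr
    | 0 => graphArray Q
    | 1 => eventArray S z
    | _ => 0
  num
    | 0 => mixArray Q
    | 1 => vertexArray Q
    | 2 => edgeArray Q
    | _ => 0

/-- The result of a computation is read off cell `0` of complex array number `3`. -/
def output (s : Memory) : ℂ := s.num 3 0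

end QAOASim

/-! Expanding every layer over computational basis states turns the marginal into a sum over pairs
of histories, one for the amplitude and one for its conjugate. Each history gives every qubit a bit
at the times `0, …, p`; both histories must end in the same string, and that string must agree with
`z` on `S`. The mixing layer is a product of one-qubit gates. The phase layer is a product of
diagonal one- and two-qubit gates, up to a global phase that the conjugate cancels. Grouped by
qubits instead of layers, the sum is the partition function of a model with one vertex per qubit, `D
= 4 ^ (p + 1)` states per vertex, and nontrivial pair interactions only along edges of the
interaction graph (`marginal_eq_partition`).

The partition function is computed by eliminating vertices. Summing out a vertex `v` with at most
two neighbours `u`, `w` gives a function of the states of `u` and `w` only, which is multiplied into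
their interaction. Both lose the neighbour `v` and gain at most each other, so all degrees stay at
most two and any elimination order works; here the last vertex goes first (`partition_elim`,
`card_nbrs_elim`, `Eliminable.elim`). One elimination needs `D ^ 2` sums of `D` terms.

The program is verified with the predicate `WP`, whose cost bound is `B ^ P.deg` with an exponent
read off the syntax of `P`. For `B = n ^ 2 * D ^ 2`, the number of table cells, all stored natural
numbers and all loop lengths stay at most `B`. The cost is thus a fixed power of `B`, that is,
polynomial in `n` times `exp (O(p))`. -/

namespace QAOASim

/-! ## Polynomial cost bounds -/

/-- `x ≤ B ^ a` with a positive exponent. -/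
def PowBound (B a x : ℕ) : Prop := 1 ≤ a ∧ x ≤ B ^ a

/-- Exponents are kept positive so that both powers are at least 2, and a sum of two numbers that
are at least 2 is at most their product. Hence exponents add for sums just as for products. -/
theorem PowBound.add {B a b x y : ℕ} (hB : 2 ≤ B) (hx : PowBound B a x) (hy : PowBound B b y) :
    PowBound B (a + b) (x + y) := by
  refine ⟨by have := hx.1; omega, ?_⟩
  have h1 : 2 ≤ B ^ a := hB.trans (Nat.le_self_pow (by have := hx.1; omega) B)
  have h2 : 2 ≤ B ^ b := hB.trans (Nat.le_self_pow (by have := hy.1; omega) B)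
  have h3 := hx.2
  have h4 := hy.2
  rw [pow_add]
  nlinarith [Nat.mul_le_mul h1 h2]

theorem PowBound.mul {B a b x y : ℕ} (hx : PowBound B a x) (hy : PowBound B b y) :
    PowBound B (a + b) (x * y) :=
  ⟨by have := hx.1; omega, by rw [pow_add]; exact Nat.mul_le_mul hx.2 hy.2⟩

theorem PowBound.mono {B a x y : ℕ} (hx : PowBound B a x) (h : y ≤ x) : PowBound B a y :=
  ⟨hx.1, h.trans hx.2⟩

theorem size_le_self (x : ℕ) : Nat.size x ≤ x := Nat.size_le.2 Nat.lt_two_pow_self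

theorem PowBound.size {B a x : ℕ} (hx : PowBound B a x) : PowBound B a (Nat.size x) :=
  hx.mono (size_le_self x)

theorem PowBound.one {B : ℕ} (hB : 2 ≤ B) : PowBound B 1 1 := ⟨le_rfl, by simp; omega⟩

theorem PowBound.const {B : ℕ} (hB : 2 ≤ B) (c : ℕ) : PowBound B (c + 1) c :=
  ⟨by omega, by
    have h1 : c < 2 ^ c := Nat.lt_two_pow_self
    have h2 : 2 ^ c ≤ 2 ^ (c + 1) := Nat.pow_le_pow_right (by omega) (by omega)
    have h3 : 2 ^ (c + 1) ≤ B ^ (c + 1) := Nat.pow_le_pow_left hB _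
    omega⟩

/-- All natural numbers in the memory are at most `B`. -/
def Memory.Bdd (B : ℕ) (s : Memory) : Prop := (∀ x, s.var x ≤ B) ∧ ∀ A i, s.arr A i ≤ B

/-- Exponent of a polynomial bound for the value of an expression. -/
def NExp.deg : NExp → ℕ
  | .const c => c + 1
  | .var _ => 1
  | .load _ _ => 1
  | .add a b => a.deg + b.deg
  | .sub a _ => a.deg
  | .mul a b => a.deg + b.deg
  | .div a _ => a.deg
  | .mod a _ => a.deg

/-- Intermediate values may exceed `B`, but only polynomially, with an exponent that depends on the
expression alone. -/
theorem NExp.eval_bound {B : ℕ} (hB : 2 ≤ B) {s : Memory} (hs : s.Bdd B) (e : NExp) :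
    PowBound B e.deg (e.eval s) := by
  induction e with
  | const c => exact PowBound.const hB c
  | var x => exact ⟨le_rfl, by simpa [NExp.deg, NExp.eval] using hs.1 x⟩
  | load A i _ => exact ⟨le_rfl, by simpa [NExp.deg, NExp.eval] using hs.2 A (i.eval s)⟩
  | add a b iha ihb => exact iha.add hB ihb
  | sub a b iha _ => exact iha.mono (Nat.sub_le _ _)
  | mul a b iha ihb => exact iha.mul ihb
  | div a b iha _ => exact iha.mono (Nat.div_le_self _ _)
  | mod a b iha _ => exact iha.mono (Nat.mod_le _ _)

/-- Exponent of a polynomial bound for the cost of a natural-number expression. -/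
def NExp.costDeg : NExp → ℕ
  | .const c => 1 + (c + 1)
  | .var _ => 1 + 1
  | .load _ i => i.costDeg + 1 + i.deg + 1
  | .add a b => a.costDeg + b.costDeg + 1 + a.deg + b.deg
  | .sub a b => a.costDeg + b.costDeg + 1 + a.deg + b.deg
  | .mul a b => a.costDeg + b.costDeg + 1 + a.deg + b.deg
  | .div a b => a.costDeg + b.costDeg + 1 + a.deg + b.deg
  | .mod a b => a.costDeg + b.costDeg + 1 + a.deg + b.deg

theorem NExp.cost_bound {B : ℕ} (hB : 2 ≤ B) {s : Memory} (hs : s.Bdd B) (e : NExp) :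
    PowBound B e.costDeg (e.cost s) := by
  have bin : ∀ a b : NExp, PowBound B a.costDeg (a.cost s) → PowBound B b.costDeg (b.cost s) →
      PowBound B (a.costDeg + b.costDeg + 1 + a.deg + b.deg)
        (a.cost s + b.cost s + 1 + Nat.size (a.eval s) + Nat.size (b.eval s)) :=
    fun a b ha hb => (((ha.add hB hb).add hB (.one hB)).add hB (a.eval_bound hB hs).size).add hB
      (b.eval_bound hB hs).size
  induction e with
  | const c => exact (PowBound.one hB).add hB (PowBound.const hB c).size
  | var x => exact (PowBound.one hB).add hB ((NExp.var x).eval_bound hB hs).size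
  | load A i ih =>
    exact ((ih.add hB (.one hB)).add hB (i.eval_bound hB hs).size).add hB
      ((NExp.load A i).eval_bound hB hs).size
  | add a b iha ihb => exact bin a b iha ihb
  | sub a b iha ihb => exact bin a b iha ihb
  | mul a b iha ihb => exact bin a b iha ihb
  | div a b iha ihb => exact bin a b iha ihb
  | mod a b iha ihb => exact bin a b iha ihb

/-- Exponent of a polynomial bound for the cost of a complex expression. -/
def CExp.costDeg : CExp → ℕ
  | .const _ => 1
  | .load _ i => i.costDeg + 1 + i.deg
  | .add a b => a.costDeg + b.costDeg + 1
  | .sub a b => a.costDeg + b.costDeg + 1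
  | .mul a b => a.costDeg + b.costDeg + 1
  | .conj a => a.costDeg + 1

theorem CExp.cost_bound {B : ℕ} (hB : 2 ≤ B) {s : Memory} (hs : s.Bdd B) (e : CExp) :
    PowBound B e.costDeg (e.cost s) := by
  induction e with
  | const c => exact .one hB
  | load A i =>
    exact ((i.cost_bound hB hs).add hB (.one hB)).add hB (i.eval_bound hB hs).size
  | add a b iha ihb => exact (iha.add hB ihb).add hB (.one hB)
  | sub a b iha ihb => exact (iha.add hB ihb).add hB (.one hB)
  | mul a b iha ihb => exact (iha.add hB ihb).add hB (.one hB)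
  | conj a iha => exact iha.add hB (.one hB)

/-- Exponent of a polynomial bound for the cost of a test. -/
def testDeg (a b : NExp) : ℕ := a.costDeg + b.costDeg + 1 + a.deg + b.deg

theorem testCost_bound {B : ℕ} (hB : 2 ≤ B) {s : Memory} (hs : s.Bdd B) (a b : NExp) :
    PowBound B (testDeg a b) (testCost s a b) :=
  ((((a.cost_bound hB hs).add hB (b.cost_bound hB hs)).add hB (.one hB)).add hB
    (a.eval_bound hB hs).size).add hB (b.eval_bound hB hs).size

/-- Exponent of a polynomial bound for the cost of a program in a memory bounded by `B` all of
whose loops run for at most `B` rounds. -/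
def Prog.deg : Prog → ℕ
  | .skip => 1
  | .setVar _ e => e.costDeg + 1 + e.deg
  | .setArr _ i e => i.costDeg + e.costDeg + 1 + i.deg + e.deg
  | .setNum _ i c => i.costDeg + c.costDeg + 1 + i.deg
  | .seq P P' => P.deg + P'.deg
  | .ifLt a b P P' => testDeg a b + (P.deg + P'.deg)
  | .whileLt a b P => 2 + (testDeg a b + P.deg)

/-! ## Frames -/

/-- The variables a program may write. -/
def Prog.writtenVars : Prog → List ℕ
  | .skip => []
  | .setVar x _ => [x]
  | .setArr _ _ _ => []
  | .setNum _ _ _ => []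
  | .seq P P' => P.writtenVars ++ P'.writtenVars
  | .ifLt _ _ P P' => P.writtenVars ++ P'.writtenVars
  | .whileLt _ _ P => P.writtenVars

/-- The natural-number arrays a program may write. -/
def Prog.writtenArrs : Prog → List ℕ
  | .skip => []
  | .setVar _ _ => []
  | .setArr A _ _ => [A]
  | .setNum _ _ _ => []
  | .seq P P' => P.writtenArrs ++ P'.writtenArrs
  | .ifLt _ _ P P' => P.writtenArrs ++ P'.writtenArrs
  | .whileLt _ _ P => P.writtenArrs

/-- The complex arrays a program may write. -/
def Prog.writtenNums : Prog → List ℕ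
  | .skip => []
  | .setVar _ _ => []
  | .setArr _ _ _ => []
  | .setNum A _ _ => [A]
  | .seq P P' => P.writtenNums ++ P'.writtenNums
  | .ifLt _ _ P P' => P.writtenNums ++ P'.writtenNums
  | .whileLt _ _ P => P.writtenNums

/-- `s'` agrees with `s` on everything that `P` does not write. -/
structure Frame (P : Prog) (s s' : Memory) : Prop where
  var : ∀ x, x ∉ P.writtenVars → s'.var x = s.var x
  arr : ∀ A, A ∉ P.writtenArrs → s'.arr A = s.arr A
  num : ∀ A, A ∉ P.writtenNums → s'.num A = s.num A

theorem Frame.refl (P : Prog) (s : Memory) : Frame P s s :=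
  ⟨fun _ _ => rfl, fun _ _ => rfl, fun _ _ => rfl⟩

theorem Frame.trans {P : Prog} {s s₁ s₂ : Memory} (h : Frame P s s₁) (h' : Frame P s₁ s₂) :
    Frame P s s₂ :=
  ⟨fun x hx => (h'.var x hx).trans (h.var x hx), fun x hx => (h'.arr x hx).trans (h.arr x hx),
    fun x hx => (h'.num x hx).trans (h.num x hx)⟩

theorem Frame.mono {P P' : Prog} {s s' : Memory} (h : Frame P s s')
    (hv : P.writtenVars ⊆ P'.writtenVars) (ha : P.writtenArrs ⊆ P'.writtenArrs)
    (hn : P.writtenNums ⊆ P'.writtenNums) : Frame P' s s' :=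
  ⟨fun x hx => h.var x fun h' => hx (hv h'), fun x hx => h.arr x fun h' => hx (ha h'),
    fun x hx => h.num x fun h' => hx (hn h')⟩

theorem Run.frame {P : Prog} {s s' : Memory} {t : ℕ} (h : Run P s t s') : Frame P s s' := by
  induction h with
  | skip s => exact .refl _ _
  | setVar x e s =>
    exact ⟨fun y hy => Function.update_of_ne (by simpa [Prog.writtenVars] using hy) _ _,
      fun _ _ => rfl, fun _ _ => rfl⟩
  | setArr A i e s =>
    exact ⟨fun _ _ => rfl,
      fun y hy => Function.update_of_ne (by simpa [Prog.writtenArrs] using hy) _ _,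
      fun _ _ => rfl⟩
  | setNum A i c s =>
    exact ⟨fun _ _ => rfl, fun _ _ => rfl,
      fun y hy => Function.update_of_ne (by simpa [Prog.writtenNums] using hy) _ _⟩
  | seq _ _ ih ih' =>
    exact (ih.mono (List.subset_append_left _ _) (List.subset_append_left _ _)
      (List.subset_append_left _ _)).trans (ih'.mono (List.subset_append_right _ _)
      (List.subset_append_right _ _) (List.subset_append_right _ _))
  | ifTrue _ _ ih =>
    exact ih.mono (List.subset_append_left _ _) (List.subset_append_left _ _)
      (List.subset_append_left _ _)
  | ifFalse _ _ ih =>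
    exact ih.mono (List.subset_append_right _ _) (List.subset_append_right _ _)
      (List.subset_append_right _ _)
  | whileTrue _ _ _ ih ih' =>
    refine Frame.trans (ih.mono ?_ ?_ ?_) ih' <;> exact List.Subset.refl _
  | whileFalse _ => exact .refl _ _

/-! ## Weakest preconditions with a cost bound -/

/-- From `s` the program `P` halts at cost at most `B ^ P.deg`, in a memory bounded by `B` that
satisfies `Post`. -/
def WP (B : ℕ) (P : Prog) (Post : Memory → Prop) (s : Memory) : Prop :=
  ∃ t s', Run P s t s' ∧ PowBound B P.deg t ∧ s'.Bdd B ∧ Post s'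

variable {B : ℕ} {Post : Memory → Prop} {s : Memory}

/-- The consequence also receives the frame of the run, so a postcondition needs to describe only
what `P` changes. -/
theorem WP.mono {P : Prog} {R : Memory → Prop} (h : WP B P R s)
    (hR : ∀ s', s'.Bdd B → Frame P s s' → R s' → Post s') : WP B P Post s := by
  obtain ⟨t, s', hr, ht, hs', h⟩ := h
  exact ⟨t, s', hr, ht, hs', hR s' hs' hr.frame h⟩

theorem wp_skip (hB : 2 ≤ B) (hs : s.Bdd B) (h : Post s) : WP B .skip Post s :=
  ⟨1, s, .skip s, .one hB, hs, h⟩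

theorem wp_setVar (hB : 2 ≤ B) (hs : s.Bdd B) {x : ℕ} {e : NExp} (he : e.eval s ≤ B)
    (h : Memory.Bdd B { s with var := Function.update s.var x (e.eval s) } →
      Post { s with var := Function.update s.var x (e.eval s) }) :
    WP B (.setVar x e) Post s := by
  have hb : Memory.Bdd B { s with var := Function.update s.var x (e.eval s) } := by
    refine ⟨fun y => ?_, hs.2⟩
    simp only [Function.update_apply]
    split_ifs
    exacts [he, hs.1 y]
  exact ⟨_, _, .setVar x e s,
    ((e.cost_bound hB hs).add hB (.one hB)).add hB (e.eval_bound hB hs).size, hb, h hb⟩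

theorem wp_setArr (hB : 2 ≤ B) (hs : s.Bdd B) {A : ℕ} {i e : NExp} (he : e.eval s ≤ B)
    (h : Post { s with arr := Function.update s.arr A
                          (Function.update (s.arr A) (i.eval s) (e.eval s)) }) :
    WP B (.setArr A i e) Post s := by
  refine ⟨_, _, .setArr A i e s, ((((i.cost_bound hB hs).add hB (e.cost_bound hB hs)).add hB
    (.one hB)).add hB (i.eval_bound hB hs).size).add hB (e.eval_bound hB hs).size,
    ⟨hs.1, fun A' j => ?_⟩, h⟩
  simp only [Function.update_apply]
  split_ifs with h1
  · subst h1
    simp only [Function.update_apply]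
    split_ifs
    exacts [he, hs.2 _ j]
  · exact hs.2 A' j

theorem wp_setNum (hB : 2 ≤ B) (hs : s.Bdd B) {A : ℕ} {i : NExp} {c : CExp}
    (h : Post { s with num := Function.update s.num A
                          (Function.update (s.num A) (i.eval s) (c.eval s)) }) :
    WP B (.setNum A i c) Post s :=
  ⟨_, _, .setNum A i c s, (((i.cost_bound hB hs).add hB (c.cost_bound hB hs)).add hB
    (.one hB)).add hB (i.eval_bound hB hs).size, hs, h⟩

theorem wp_seq (hB : 2 ≤ B) {P P' : Prog} (h : WP B P (fun s' => s'.Bdd B → WP B P' Post s') s) :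
    WP B (.seq P P') Post s := by
  obtain ⟨t₁, s₁, hr₁, ht₁, hs₁, h⟩ := h
  obtain ⟨t₂, s₂, hr₂, ht₂, hs₂, h⟩ := h hs₁
  exact ⟨_, _, .seq hr₁ hr₂, ht₁.add hB ht₂, hs₂, h⟩

theorem Prog.one_le_deg (P : Prog) : 1 ≤ P.deg := by
  induction P with
  | skip => exact le_rfl
  | setVar | setArr | setNum => simp only [Prog.deg]; omega
  | seq => simp only [Prog.deg]; omega
  | ifLt => simp only [Prog.deg]; omega
  | whileLt => simp only [Prog.deg]; omega

theorem wp_ifLt (hB : 2 ≤ B) (hs : s.Bdd B) {a b : NExp} {P P' : Prog}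
    (h : a.eval s < b.eval s → WP B P Post s) (h' : ¬ a.eval s < b.eval s → WP B P' Post s) :
    WP B (.ifLt a b P P') Post s := by
  have key : ∀ t d, PowBound B d t → d ≤ P.deg + P'.deg →
      PowBound B (Prog.ifLt a b P P').deg (testCost s a b + t) := fun t d ht hd =>
    (testCost_bound hB hs a b).add hB
      ⟨by have := ht.1; omega, ht.2.trans (Nat.pow_le_pow_right (by omega) hd)⟩
  by_cases hc : a.eval s < b.eval s
  · obtain ⟨t, s', hr, ht, hs', h⟩ := h hc
    exact ⟨_, _, .ifTrue hc hr, key _ _ ht (by omega), hs', h⟩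
  · obtain ⟨t, s', hr, ht, hs', h⟩ := h' hc
    exact ⟨_, _, .ifFalse hc hr, key _ _ ht (by omega), hs', h⟩

/-- `for x := 0, 1, … while x < e do P`. -/
def Prog.forLt (x : ℕ) (e : NExp) (P : Prog) : Prog :=
  .seq (.setVar x (.const 0))
    (.whileLt (.var x) e (.seq P (.setVar x (.add (.var x) (.const 1)))))

/-- The body leaves the counter alone, the invariant survives writes to the counter, and the loop
bound evaluates to `N` in every memory that the loop can reach. So there are exactly `N` rounds. -/
theorem wp_forLt (hB : 2 ≤ B) (hs : s.Bdd B) {x : ℕ} {e : NExp} {P : Prog} (N : ℕ) (hN : N ≤ B)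
    (I : ℕ → Memory → Prop) (hx : x ∉ P.writtenVars)
    (hset : ∀ i s a, I i s → I i { s with var := Function.update s.var x a })
    (he : ∀ s', Frame (.forLt x e P) s s' → e.eval s' = N)
    (h0 : I 0 s)
    (hstep : ∀ i, i < N → ∀ s', s'.Bdd B → Frame (.forLt x e P) s s' → s'.var x = i → I i s' →
      WP B P (I (i + 1)) s')
    (hpost : ∀ s', s'.Bdd B → Frame (.forLt x e P) s s' → I N s' → Post s') :
    WP B (.forLt x e P) Post s := by
  -- Induction on the number `k` of remaining rounds; `k + 1` counts the tests, including the last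
  -- one, which fails.
  have loop : ∀ k i, i + k = N → ∀ s', s'.Bdd B → Frame (.forLt x e P) s s' → s'.var x = i →
      I i s' → ∃ t s'', Run (.whileLt (.var x) e (.seq P (.setVar x (.add (.var x) (.const 1)))))
        s' t s'' ∧ t ≤ (k + 1) * B ^ (testDeg (.var x) e +
          (Prog.seq P (.setVar x (.add (.var x) (.const 1)))).deg) ∧ s''.Bdd B ∧
        Frame (.forLt x e P) s s'' ∧ I N s'' := by
    intro k
    induction k with
    | zero =>
      intro i hi s' hs' hf hv hI
      refine ⟨_, s', .whileFalse ?_, ?_, hs', hf, ?_⟩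
      · simp only [NExp.eval, he s' hf, hv]; omega
      · simp only [zero_add, one_mul]
        exact (testCost_bound hB hs' _ e).2.trans (Nat.pow_le_pow_right (by omega) (by omega))
      · rwa [show N = i by omega]
    | succ k ih =>
      intro i hi s' hs' hf hv hI
      obtain ⟨t₁, s₁, hr₁, ht₁, hs₁, hI₁⟩ := hstep i (by omega) s' hs' hf hv hI
      have hv₁ : s₁.var x = i := (hr₁.frame.var x hx).trans hv
      obtain ⟨t₂, s₂, hr₂, ht₂, hs₂, hs₂'⟩ :
          WP B (.setVar x (.add (.var x) (.const 1)))
            (fun s₂ => s₂ = { s₁ with var := Function.update s₁.var x (i + 1) }) s₁ :=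
        wp_setVar hB hs₁ (by simp only [NExp.eval, hv₁]; omega)
          (fun _ => by simp only [NExp.eval, hv₁])
      have hrun := Run.seq hr₁ hr₂
      have hf₂ : Frame (.forLt x e P) s s₂ := by
        refine hf.trans (hrun.frame.mono ?_ ?_ ?_)
        · exact List.subset_append_right _ _
        · exact List.subset_append_right _ _
        · exact List.subset_append_right _ _
      obtain ⟨t₃, s₃, hr₃, ht₃, hs₃, hf₃, hI₃⟩ := ih (i + 1) (by omega) s₂ hs₂ hf₂
        (by rw [hs₂']; simp) (by rw [hs₂']; exact hset _ _ _ hI₁)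
      refine ⟨_, s₃, .whileTrue ?_ hrun hr₃, ?_, hs₃, hf₃, hI₃⟩
      · simp only [NExp.eval, he s' hf, hv]; omega
      · have h1 := ((testCost_bound hB hs' (.var x) e).add hB (ht₁.add hB ht₂)).2
        have h2 : ∀ D : ℕ, (k + 1 + 1) * D = D + (k + 1) * D := fun D => by ring
        rw [h2]
        exact Nat.add_le_add h1 ht₃
  refine wp_seq hB (wp_setVar hB hs (by simp [NExp.eval]) fun _ hs₀ => ?_)
  have hf₀ : Frame (.forLt x e P) s { s with var := Function.update s.var x 0 } :=
    (Run.setVar x (.const 0) s).frame.mono (List.subset_append_left _ _)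
      (List.subset_append_left _ _) (List.subset_append_left _ _)
  obtain ⟨t, s', hr, ht, hs', hf, hI⟩ := loop N 0 (by omega) _ hs₀ hf₀ (by simp [NExp.eval])
    (hset _ _ _ h0)
  refine ⟨t, s', hr, ⟨Prog.one_le_deg _, ht.trans ?_⟩, hs', hpost s' hs' hf hI⟩
  simp only [Prog.deg]
  -- `N + 1 ≤ B ^ 2` since `N ≤ B` and `2 ≤ B`; this is the summand `2` in the degree of a loop.
  rw [pow_add B 2]
  exact Nat.mul_le_mul (by nlinarith) le_rfl

/-! ## Partition functions of pairwise interactions and elimination of a vertex -/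

/-- The product of all interactions of the configuration `σ`; `F j j` is a weight of the single
vertex `j`. -/
def configWeight {D m : ℕ} (F : ℕ → ℕ → ℕ → ℕ → ℂ) (σ : Fin m → Fin D) : ℂ :=
  ∏ j : Fin m, ∏ k : Fin m, if (j : ℕ) ≤ k then F j k (σ j) (σ k) else 1

/-- Partition function of `m` vertices with `D` states each. -/
def partition (D m : ℕ) (F : ℕ → ℕ → ℕ → ℕ → ℂ) : ℂ :=
  ∑ σ : Fin m → Fin D, configWeight F σ

theorem partition_congr {D m : ℕ} {F G : ℕ → ℕ → ℕ → ℕ → ℂ}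
    (h : ∀ j k c d, j ≤ k → k < m → c < D → d < D → F j k c d = G j k c d) :
    partition D m F = partition D m G := by
  refine Finset.sum_congr rfl fun σ _ => Finset.prod_congr rfl fun j _ =>
    Finset.prod_congr rfl fun k _ => ?_
  split_ifs with hjk
  · exact h _ _ _ _ hjk k.2 (σ j).2 (σ k).2
  · rfl

theorem configWeight_snoc {D v : ℕ} (F : ℕ → ℕ → ℕ → ℕ → ℂ) (σ : Fin v → Fin D) (e : Fin D) :
    configWeight F (Fin.snoc σ e : Fin (v + 1) → Fin D) =
      configWeight F σ * ((∏ j : Fin v, F j v (σ j) e) * F v v e e) := by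
  simp [configWeight, Fin.prod_univ_castSucc, Finset.prod_mul_distrib, Fin.le_last]

theorem partition_succ (D v : ℕ) (F : ℕ → ℕ → ℕ → ℕ → ℂ) :
    partition D (v + 1) F = ∑ σ : Fin v → Fin D,
      configWeight F σ * ∑ e : Fin D, (∏ j : Fin v, F j v (σ j) e) * F v v e e := by
  rw [partition, ← (Fin.snocEquiv fun _ : Fin (v + 1) => Fin D).sum_comp, Fintype.sum_prod_type,
    Finset.sum_comm]
  refine Finset.sum_congr rfl fun σ _ => ?_
  rw [Finset.mul_sum]
  exact Finset.sum_congr rfl fun e _ => configWeight_snoc F σ e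

theorem partition_one (D : ℕ) (F : ℕ → ℕ → ℕ → ℕ → ℂ) :
    partition D 1 F = ∑ e ∈ Finset.range D, F 0 0 e e := by
  rw [partition_succ]
  simp [configWeight, Finset.sum_range]

/-- The message of vertex `v` to the vertices `u`, `w` when `v` is summed out. -/
def message (D : ℕ) (F : ℕ → ℕ → ℕ → ℕ → ℂ) (v u w c d : ℕ) : ℂ :=
  ∑ e ∈ Finset.range D, F v v e e * F u v c e * if u < w then F w v d e else 1

/-- The interactions after elimination of `v`. -/
def elim (D : ℕ) (F : ℕ → ℕ → ℕ → ℕ → ℂ) (v u w : ℕ) : ℕ → ℕ → ℕ → ℕ → ℂ := fun j k c d =>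
  if j = u ∧ k = w then F j k c d * message D F v u w c d else F j k c d

/-- Only the factors at `(u, v)`, `(w, v)` and `(v, v)` can depend on the state of `v`, so the sum
over that state is a function of the states of `u` and `w`. If `u = w`, the message depends on one
state only and is absorbed into the vertex weight `F u u`; this covers a vertex `v` with one
neighbour or none. -/
theorem partition_elim {D v u w : ℕ} {F : ℕ → ℕ → ℕ → ℕ → ℂ} (huw : u ≤ w) (hwv : w < v)
    (hone : ∀ j, j < v → j ≠ u → j ≠ w → ∀ c e, c < D → e < D → F j v c e = 1) :
    partition D (v + 1) F = partition D v (elim D F v u w) := by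
  rw [partition_succ, partition]
  refine Finset.sum_congr rfl fun σ _ => ?_
  set U : Fin v := ⟨u, by omega⟩ with hU
  set W : Fin v := ⟨w, hwv⟩ with hW
  have hprod : ∀ e : Fin D, ∏ j : Fin v, F j v (σ j) e =
      F u v (σ U) e * if u < w then F w v (σ W) e else 1 := by
    intro e
    split_ifs with hlt
    · rw [Finset.prod_eq_mul U W (by simp [hU, hW]; omega)]
      · rintro j - ⟨h1, h2⟩
        exact hone j j.2 (fun h => h1 (Fin.ext h)) (fun h => h2 (Fin.ext h)) _ _ (σ j).2 e.2
      · simp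
      · simp
    · rw [mul_one, Finset.prod_eq_single U]
      · rintro j - h1
        have : u = w := by omega
        exact hone j j.2 (fun h => h1 (Fin.ext h)) (fun h => h1 (Fin.ext (h.trans this.symm)))
          _ _ (σ j).2 e.2
      · simp
  have hm : ∑ e : Fin D, (∏ j : Fin v, F j v (σ j) e) * F v v e e =
      message D F v u w (σ U) (σ W) := by
    rw [message, Finset.sum_range]
    exact Finset.sum_congr rfl fun e _ => by rw [hprod]; ring
  rw [hm, configWeight, configWeight]
  -- The message is attached to the single pair `(U, W)`, which occurs in the ordered product
  -- because `u ≤ w`.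
  have hfac : ∀ j k : Fin v, (if (j : ℕ) ≤ k then elim D F v u w j k (σ j) (σ k) else 1) =
      (if (j : ℕ) ≤ k then F j k (σ j) (σ k) else 1) *
        if j = U then (if k = W then message D F v u w (σ U) (σ W) else 1) else 1 := by
    intro j k
    by_cases hj : j = U
    · by_cases hk : k = W
      · simp [elim, hj, hk, huw, show (U : ℕ) = u from rfl, show (W : ℕ) = w from rfl]
      · have : (k : ℕ) ≠ w := fun h => hk (Fin.ext h)
        simp [elim, hk, this]
    · have : (j : ℕ) ≠ u := fun h => hj (Fin.ext h)
      simp [elim, hj, this]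
  simp_rw [hfac, Finset.prod_mul_distrib]
  congr 1
  rw [Finset.prod_eq_single U]
  · simp
  · intro j _ hj; simp [hj]
  · simp

/-- The neighbours of `v` among the first `m` vertices, for a table `a` read above the diagonal. -/
def nbrs (a : ℕ → ℕ → ℕ) (m v : ℕ) : Finset ℕ :=
  (Finset.range m).filter fun k => k < v ∧ 0 < a k v ∨ v < k ∧ 0 < a v k

theorem mem_nbrs {a : ℕ → ℕ → ℕ} {m v k : ℕ} :
    k ∈ nbrs a m v ↔ k < m ∧ (k < v ∧ 0 < a k v ∨ v < k ∧ 0 < a v k) := by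
  rw [nbrs, Finset.mem_filter, Finset.mem_range]

/-- Each of `u`, `w` trades the neighbour `v` for the other one, and every other vertex gains
nothing. If `u = w`, the new entry lies on the diagonal, which `nbrs` never reads. -/
theorem card_nbrs_elim {a : ℕ → ℕ → ℕ} {v u w : ℕ}
    (h : ∀ x, x < v + 1 → (nbrs a (v + 1) x).card ≤ 2) (huw : u ≤ w)
    (hadj : u < w → 0 < a u v ∧ 0 < a w v) {x : ℕ} (hx : x < v) :
    (nbrs (fun j k => if j = u ∧ k = w then 1 else a j k) v x).card ≤ 2 := by
  have key : ∀ y z, x = y → 0 < a y v →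
      nbrs (fun j k => if j = u ∧ k = w then 1 else a j k) v x ⊆
        insert z ((nbrs a (v + 1) x).erase v) →
      (nbrs (fun j k => if j = u ∧ k = w then 1 else a j k) v x).card ≤ 2 := by
    intro y z hy ha hsub
    have hv : v ∈ nbrs a (v + 1) x := by
      simp only [nbrs, Finset.mem_filter, Finset.mem_range]; subst hy; exact ⟨by omega, .inr ⟨hx, ha⟩⟩
    have h1 := Finset.card_le_card hsub
    have h2 := Finset.card_insert_le z ((nbrs a (v + 1) x).erase v)
    have h3 := Finset.card_erase_of_mem hv
    have h4 := h x (by omega)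
    omega
  by_cases hlt : u < w
  · by_cases hxu : x = u
    · refine key u w hxu (hadj hlt).1 fun k => ?_
      simp only [nbrs, Finset.mem_filter, Finset.mem_range, Finset.mem_insert, Finset.mem_erase]
      split_ifs <;> grind
    · by_cases hxw : x = w
      · refine key w u hxw (hadj hlt).2 fun k => ?_
        simp only [nbrs, Finset.mem_filter, Finset.mem_range, Finset.mem_insert, Finset.mem_erase]
        split_ifs <;> grind
      · refine (Finset.card_le_card fun k => ?_).trans (h x (by omega))
        simp only [nbrs, Finset.mem_filter, Finset.mem_range]
        split_ifs <;> grind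
  · refine (Finset.card_le_card fun k => ?_).trans (h x (by omega))
    simp only [nbrs, Finset.mem_filter, Finset.mem_range]
    split_ifs <;> grind

/-- `w` is the largest number below `i` with property `q`, or `0` if there is none. -/
def IsLastBelow (q : ℕ → Prop) (i w : ℕ) : Prop :=
  (q w ∧ w < i ∧ ∀ k, k < i → q k → k ≤ w) ∨ (w = 0 ∧ ∀ k, k < i → ¬ q k)

/-- `u` is the least number in `[i, v)` with property `q`, or `0` if there is none. -/
def IsFirstFrom (q : ℕ → Prop) (v i u : ℕ) : Prop :=
  (q u ∧ u < v ∧ i ≤ u ∧ ∀ k, i ≤ k → k < v → q k → u ≤ k) ∨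
    (u = 0 ∧ ∀ k, i ≤ k → k < v → ¬ q k)

/-- A neighbour other than the first and the last would lie strictly between them and make three.
Without neighbours both searches return the default `0`, an admissible vertex below `v`. -/
theorem nbrs_extremes {a : ℕ → ℕ → ℕ} {v u w : ℕ} (hv : 0 < v)
    (h : (nbrs a (v + 1) v).card ≤ 2) (hw : IsLastBelow (fun k => 0 < a k v) v w)
    (hu : IsFirstFrom (fun k => 0 < a k v) v 0 u) :
    u ≤ w ∧ w < v ∧ (u < w → 0 < a u v ∧ 0 < a w v) ∧
      ∀ j, j < v → j ≠ u → j ≠ w → a j v = 0 := by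
  rcases hw with ⟨h1, h2, h3⟩ | ⟨rfl, h3⟩
  · rcases hu with ⟨g1, g2, -, g3⟩ | ⟨rfl, g3⟩
    · refine ⟨h3 u g2 g1, h2, fun _ => ⟨g1, h1⟩, fun j hj hju hjw => ?_⟩
      by_contra hne
      have hpos : 0 < a j v := Nat.pos_of_ne_zero hne
      have a1 := g3 j (by omega) hj hpos
      have a2 := h3 j hj hpos
      have hsub : ({u, j, w} : Finset ℕ) ⊆ nbrs a (v + 1) v := by
        intro x
        simp only [nbrs, Finset.mem_filter, Finset.mem_range, Finset.mem_insert,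
          Finset.mem_singleton]
        grind
      have := Finset.card_le_card hsub
      rw [Finset.card_eq_three.2 ⟨u, j, w, by omega, by omega, by omega, rfl⟩] at this
      omega
    · exact absurd h1 (g3 w (by omega) h2)
  · rcases hu with ⟨g1, g2, -, g3⟩ | ⟨rfl, g3⟩
    · exact absurd g1 (h3 u g2)
    · refine ⟨le_rfl, hv, fun h => absurd h (lt_irrefl _), fun j hj _ _ => ?_⟩
      have := h3 j hj
      omega

/-- The state of the elimination: non-adjacent vertices do not interact, and all degrees are at
most two. -/
structure Eliminable (D m : ℕ) (a : ℕ → ℕ → ℕ) (F : ℕ → ℕ → ℕ → ℕ → ℂ) : Prop where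
  one : ∀ j k c d, j < k → k < m → a j k = 0 → c < D → d < D → F j k c d = 1
  card : ∀ x, x < m → (nbrs a m x).card ≤ 2

/-- The only interaction that changes is that of `(u, w)`. This pair is marked adjacent, so nothing
is required of its new interaction. -/
theorem Eliminable.elim {D v u w : ℕ} {a : ℕ → ℕ → ℕ} {F : ℕ → ℕ → ℕ → ℕ → ℂ} (hv : 0 < v)
    (h : Eliminable D (v + 1) a F) (hw : IsLastBelow (fun k => 0 < a k v) v w)
    (hu : IsFirstFrom (fun k => 0 < a k v) v 0 u) :
    u ≤ w ∧ w < v ∧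
    Eliminable D v (fun j k => if j = u ∧ k = w then 1 else a j k) (elim D F v u w) ∧
      partition D v (QAOASim.elim D F v u w) = partition D (v + 1) F := by
  obtain ⟨huw, hwv, hadj, hne⟩ := nbrs_extremes hv (h.card v (by omega)) hw hu
  refine ⟨huw, hwv, ⟨fun j k c d hjk hk ha hc hd => ?_,
    fun x hx => card_nbrs_elim h.card huw hadj hx⟩,
    (partition_elim huw hwv fun j hj h1 h2 c e hc he =>
      h.one j v c e hj (by omega) (hne j hj h1 h2) hc he).symm⟩
  by_cases hc' : j = u ∧ k = w
  · simp [hc'] at ha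
  · simp only [hc', if_false] at ha
    simp only [QAOASim.elim, hc', if_false]
    exact h.one j k c d hjk (by omega) ha hc hd

/-! ## The table of interactions

A state `c < 4 ^ (p + 1)` of a vertex encodes the values of its qubit along a pair of histories:
the base-`4` digit number `l` of `c` is `2 * a + b`, with the bit `a` of the first history and the
bit `b` of the second history at time `l`. -/

/-- The bit of the first history at time `l`, where `q = 4 ^ l`. -/
def fwd (c q : ℕ) : ℕ := c / q % 4 / 2

/-- The bit of the second history at time `l`, where `q = 4 ^ l`. -/
def bwd (c q : ℕ) : ℕ := c / q % 4 % 2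

/-- Expression for `fwd`. -/
def fwdExp (c q : NExp) : NExp := .div (.mod (.div c q) (.const 4)) (.const 2)

/-- Expression for `bwd`. -/
def bwdExp (c q : NExp) : NExp := .mod (.mod (.div c q) (.const 4)) (.const 2)

@[simp] theorem eval_fwdExp (c q : NExp) : (fwdExp c q).eval s = fwd (c.eval s) (q.eval s) := rfl

@[simp] theorem eval_bwdExp (c q : NExp) : (bwdExp c q).eval s = bwd (c.eval s) (q.eval s) := rfl

/-- Contribution of layer `l` to the interaction of `j` and `k`. -/
noncomputable def edgeFactor (n : ℕ) (E : ℕ → ℂ) (j k c d l : ℕ) : ℂ :=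
  E ((((l * n + j) * n + k) * 2 + fwd c (4 ^ l)) * 2 + fwd d (4 ^ l)) *
    (starRingEnd ℂ) (E ((((l * n + j) * n + k) * 2 + bwd c (4 ^ l)) * 2 + bwd d (4 ^ l)))

/-- Contribution of layer `l` to the weight of `j`. -/
noncomputable def vertexFactor (n : ℕ) (V M : ℕ → ℂ) (j c l : ℕ) : ℂ :=
  V ((l * n + j) * 2 + fwd c (4 ^ l)) *
      M ((l * 2 + fwd c (4 ^ l * 4)) * 2 + fwd c (4 ^ l)) *
    (starRingEnd ℂ) (V ((l * n + j) * 2 + bwd c (4 ^ l)) *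
      M ((l * 2 + bwd c (4 ^ l * 4)) * 2 + bwd c (4 ^ l)))

/-- Positive iff the bits `a`, `b` differ or contradict the entry `e` of the event array. -/
def violation (e a b : ℕ) : ℕ := (a - b) + (b - a) + e * ((e - (1 + a)) + ((1 + a) - e))

/-- The initial interactions, computed from the input arrays: adjacency `G`, event `S`, mixing
gates `M`, one-qubit phase gates `V`, two-qubit phase gates `E`. -/
noncomputable def initTable (n p : ℕ) (G S : ℕ → ℕ) (M V E : ℕ → ℂ) (j k c d : ℕ) : ℂ :=
  if j < k then
    if 0 < G (j * n + k) then ∏ l ∈ Finset.range p, edgeFactor n E j k c d l else 1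
  else
    if 0 < violation (S j) (fwd c (4 ^ p)) (bwd c (4 ^ p)) then 0
    else ((1 / 2 : ℚ) : ℂ) * ∏ l ∈ Finset.range p, vertexFactor n V M j c l

/-! ### Register allocation

Variables: `0` is `n`, `1` is `p`, `2` is `D = 4 ^ (p + 1)`, `3` a table index, `4` the layer `l`,
`5` is `4 ^ l`, `6` counts eliminated vertices, `7` the vertex `v` to be eliminated, `8` and `9` its
neighbours `u`, `w`, `10` and `11` loop counters, `12` to `15` the decoded table index `j k c d`.
Complex array `4` is the table, complex array `3` holds the accumulator and the result. -/

/-- `D := 4 ^ (p + 1)`. -/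
def stateCountProg : Prog :=
  .seq (.setVar 2 (.const 4)) (.forLt 4 (.var 1) (.setVar 2 (.mul (.var 2) (.const 4))))

theorem wp_stateCount (hB : 2 ≤ B) (hs : s.Bdd B) {p : ℕ} (hp : s.var 1 = p) (hpB : p ≤ B)
    (hD : 4 ^ (p + 1) ≤ B) : WP B stateCountProg (fun s' => s'.var 2 = 4 ^ (p + 1)) s := by
  have h4 : 4 ≤ B := le_trans (by rw [pow_succ]; have := Nat.one_le_pow p 4 (by norm_num); omega) hD
  refine wp_seq hB (wp_setVar hB hs h4 fun hs₁ _ => ?_)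
  refine wp_forLt hB hs₁ p hpB (fun i s' => s'.var 2 = 4 ^ (i + 1)) (by decide) ?_ ?_ ?_ ?_ ?_
  · intro i s' a h
    simpa [Function.update_apply] using h
  · intro s' hf
    simp only [NExp.eval]
    rw [hf.var 1 (by decide)]
    simpa [Function.update_apply] using hp
  · simp [NExp.eval]
  · intro i hi s' hs' hf h4 hI
    have : 4 ^ (i + 1 + 1) ≤ 4 ^ (p + 1) := Nat.pow_le_pow_right (by norm_num) (by omega)
    refine wp_setVar hB hs' ?_ fun _ => ?_
    · simp only [NExp.eval, hI]; rw [← pow_succ]; omega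
    · simp [NExp.eval, hI, pow_succ]
  · intro s' _ _ h; exact h

/-- `table[i] := table[i] * f` for all layers. -/
def productProg (f : CExp) : Prog :=
  .forLt 4 (.var 1) (.seq (.setNum 4 (.var 3) (.mul (.load 4 (.var 3)) f))
    (.setVar 5 (.mul (.var 5) (.const 4))))

/-- Shared by both kinds of table cells. Register `5` carries `4 ^ l`, by which the bits at time `l`
are extracted; its final value `4 ^ p` serves for the bits at the last time. -/
theorem wp_product (hB : 2 ≤ B) (hs : s.Bdd B) {p i : ℕ} {f : CExp} {g : ℕ → ℂ} {T : ℕ → ℂ}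
    {x : ℂ} (hp : s.var 1 = p) (hi : s.var 3 = i) (hq : s.var 5 = 1) (hpB : p ≤ B)
    (hD : 4 ^ p ≤ B) (hT : s.num 4 = Function.update T i x)
    (hf : ∀ l s', l < p → Frame (productProg f) s s' → s'.var 4 = l → s'.var 5 = 4 ^ l →
      f.eval s' = g l) :
    WP B (productProg f) (fun s' => s'.num 4 = Function.update T i
      (x * ∏ l ∈ Finset.range p, g l) ∧ s'.var 5 = 4 ^ p) s := by
  refine wp_forLt hB hs p hpB (fun l s' => s'.num 4 = Function.update T i
      (x * ∏ l ∈ Finset.range l, g l) ∧ s'.var 5 = 4 ^ l) (by simp [Prog.writtenVars]) ?_ ?_ ?_ ?_ ?_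
  · intro l s' a h
    simpa [Function.update_apply] using h
  · intro s' hfr
    simp only [NExp.eval]
    rw [hfr.var 1 (by simp [Prog.forLt, Prog.writtenVars]), hp]
  · simp [hT, hq]
  · intro l hl s' hs' hfr h4 hI
    have hle : 4 ^ (l + 1) ≤ 4 ^ p := Nat.pow_le_pow_right (by norm_num) (by omega)
    have h3 : s'.var 3 = i := by rw [hfr.var 3 (by simp [Prog.forLt, Prog.writtenVars]), hi]
    refine wp_seq hB (wp_setNum hB hs' fun hs₁ => wp_setVar hB hs₁ ?_ fun _ => ?_)
    · simp only [NExp.eval, hI.2]; rw [← pow_succ]; omega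
    · simp [NExp.eval, CExp.eval, hI.1, hI.2, pow_succ, h3, hf l s' hl hfr h4 hI.2,
        Finset.prod_range_succ, mul_assoc]
  · intro s' _ _ h; exact h

/-- Load an entry of the two-qubit phase gate of layer `l` on `j` and `k`. -/
def edgeLoad (a b : NExp) : CExp :=
  .load 2 (.add (.mul (.add (.mul (.add (.mul (.add (.mul (.var 4) (.var 0)) (.var 12))
    (.var 0)) (.var 13)) (.const 2)) a) (.const 2)) b)

/-- Expression for `edgeFactor`. -/
def edgeFactorExp : CExp :=
  .mul (edgeLoad (fwdExp (.var 14) (.var 5)) (fwdExp (.var 15) (.var 5)))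
    (.conj (edgeLoad (bwdExp (.var 14) (.var 5)) (bwdExp (.var 15) (.var 5))))

/-- Load an entry of the one-qubit phase gate of layer `l` on `j`. -/
def vertexLoad (a : NExp) : CExp :=
  .load 1 (.add (.mul (.add (.mul (.var 4) (.var 0)) (.var 12)) (.const 2)) a)

/-- Load an entry of the mixing gate of layer `l`. -/
def mixLoad (a b : NExp) : CExp :=
  .load 0 (.add (.mul (.add (.mul (.var 4) (.const 2)) a) (.const 2)) b)

/-- Expression for `vertexFactor`. -/
def vertexFactorExp : CExp :=
  .mul (.mul (vertexLoad (fwdExp (.var 14) (.var 5)))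
      (mixLoad (fwdExp (.var 14) (.mul (.var 5) (.const 4))) (fwdExp (.var 14) (.var 5))))
    (.conj (.mul (vertexLoad (bwdExp (.var 14) (.var 5)))
      (mixLoad (bwdExp (.var 14) (.mul (.var 5) (.const 4))) (bwdExp (.var 14) (.var 5)))))

/-- Expression for `violation`. -/
def violationExp (e a b : NExp) : NExp :=
  .add (.add (.sub a b) (.sub b a))
    (.mul e (.add (.sub e (.add (.const 1) a)) (.sub (.add (.const 1) a) e)))

theorem eval_violationExp (e a b : NExp) :
    (violationExp e a b).eval s = violation (e.eval s) (a.eval s) (b.eval s) := rfl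

/-- Fill the current table cell with an interaction. -/
def edgeCellProg : Prog :=
  .seq (.setNum 4 (.var 3) (.const 1))
    (.ifLt (.const 0) (.load 0 (.add (.mul (.var 12) (.var 0)) (.var 13)))
      (productProg edgeFactorExp) .skip)

/-- Fill the current table cell with the weight of a vertex. -/
def vertexCellProg : Prog :=
  .seq (.setNum 4 (.var 3) (.const (1 / 2)))
    (.seq (productProg vertexFactorExp)
      (.ifLt (.const 0) (violationExp (.load 1 (.var 12)) (fwdExp (.var 14) (.var 5))
          (bwdExp (.var 14) (.var 5)))
        (.setNum 4 (.var 3) (.const 0)) .skip))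

/-- Fill the current table cell. -/
def cellProg : Prog := .ifLt (.var 12) (.var 13) edgeCellProg vertexCellProg

/-- Tests are possible on natural numbers only, so the branches depend on the adjacency entry and on
`violation`. A violated end condition overwrites the finished vertex weight by `0`. -/
theorem wp_cell (hB : 2 ≤ B) (hs : s.Bdd B) {n p i j k c d : ℕ} {G S : ℕ → ℕ} {M V E : ℕ → ℂ}
    (hn : s.var 0 = n) (hp : s.var 1 = p) (hi : s.var 3 = i) (hq : s.var 5 = 1)
    (hj : s.var 12 = j) (hk : s.var 13 = k) (hc : s.var 14 = c) (hd : s.var 15 = d)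
    (hG : s.arr 0 = G) (hS : s.arr 1 = S) (hM : s.num 0 = M) (hV : s.num 1 = V) (hE : s.num 2 = E)
    (hpB : p ≤ B) (hD : 4 ^ p ≤ B) :
    WP B cellProg (fun s' => s'.num 4 = Function.update (s.num 4) i
      (initTable n p G S M V E j k c d)) s := by
  refine wp_ifLt hB hs (fun hlt => ?_) (fun hlt => ?_)
  · simp only [NExp.eval, hj, hk] at hlt
    refine wp_seq hB (wp_setNum hB hs fun hs₁ => wp_ifLt hB hs₁ (fun hG' => ?_) (fun hG' => ?_))
    · simp only [NExp.eval, hj, hk, hn, hG] at hG'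
      refine (wp_product hB hs₁ (p := p) (i := i) (g := edgeFactor n E j k c d) (T := s.num 4)
        (x := 1) hp hi hq hpB hD ?_ ?_).mono fun s' _ _ h => ?_
      · simp [NExp.eval, CExp.eval, hi]
      · intro l s' hl hf h4 h5
        have e0 := hf.var 0 (by decide)
        have e12 := hf.var 12 (by decide)
        have e13 := hf.var 13 (by decide)
        have e14 := hf.var 14 (by decide)
        have e15 := hf.var 15 (by decide)
        have e2 : s'.num 2 = E := (hf.num 2 (by decide)).trans (by simp [hE])
        simp only [hn, hj, hk, hc, hd] at e0 e12 e13 e14 e15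
        simp [edgeFactorExp, edgeLoad, edgeFactor, CExp.eval, NExp.eval, h4, h5, e0, e12, e13,
          e14, e15, e2]
      · rw [h.1]; simp [initTable, hlt, hG']
    · simp only [NExp.eval, hj, hk, hn, hG] at hG'
      refine wp_skip hB hs₁ ?_
      simp [NExp.eval, CExp.eval, hi, initTable, hlt, hG']
  · simp only [NExp.eval, hj, hk] at hlt
    refine wp_seq hB (wp_setNum hB hs fun hs₁ => wp_seq hB ?_)
    refine (wp_product hB hs₁ (p := p) (i := i) (g := vertexFactor n V M j c) (T := s.num 4)
        (x := ((1 / 2 : ℚ) : ℂ)) hp hi hq hpB hD ?_ ?_).mono fun s₂ _ hf h hs₂ => ?_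
    · simp [NExp.eval, CExp.eval, hi]
    · intro l s' hl hf h4 h5
      have e0 := hf.var 0 (by decide)
      have e12 := hf.var 12 (by decide)
      have e14 := hf.var 14 (by decide)
      have f0 : s'.num 0 = M := (hf.num 0 (by decide)).trans (by simp [hM])
      have f1 : s'.num 1 = V := (hf.num 1 (by decide)).trans (by simp [hV])
      simp only [hn, hj, hc] at e0 e12 e14
      simp [vertexFactorExp, vertexLoad, mixLoad, vertexFactor, CExp.eval, NExp.eval, h4, h5, e0,
        e12, e14, f0, f1]
    · have e3 := hf.var 3 (by decide)
      have e12 := hf.var 12 (by decide)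
      have e14 := hf.var 14 (by decide)
      have f1 := hf.arr 1 (by decide)
      simp only [hi, hj, hc, hS] at e3 e12 e14 f1
      refine wp_ifLt hB hs₂ (fun hb => wp_setNum hB hs₂ ?_) (fun hb => wp_skip hB hs₂ ?_)
      · simp only [eval_violationExp, NExp.eval, eval_fwdExp, eval_bwdExp, e12, e14, f1, h.2] at hb
        rw [initTable, if_neg hlt, if_pos hb]
        simp [NExp.eval, CExp.eval, e3, h.1]
      · simp only [eval_violationExp, NExp.eval, eval_fwdExp, eval_bwdExp, e12, e14, f1, h.2] at hb
        rw [initTable, if_neg hlt, if_neg hb]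
        exact h.1

/-- Decode the table index. -/
def decodeProg : Prog :=
  .seq (.setVar 12 (.div (.div (.var 3) (.mul (.var 2) (.var 2))) (.var 0)))
  (.seq (.setVar 13 (.mod (.div (.var 3) (.mul (.var 2) (.var 2))) (.var 0)))
  (.seq (.setVar 14 (.mod (.div (.var 3) (.var 2)) (.var 2)))
  (.seq (.setVar 15 (.mod (.var 3) (.var 2)))
  (.setVar 5 (.const 1)))))

theorem wp_decode (hB : 2 ≤ B) (hs : s.Bdd B) {n D i : ℕ}
    (hn : s.var 0 = n) (hD : s.var 2 = D) (hi : s.var 3 = i) :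
    WP B decodeProg (fun s' => s'.var 12 = i / (D * D) / n ∧ s'.var 13 = i / (D * D) % n ∧
      s'.var 14 = i / D % D ∧ s'.var 15 = i % D ∧ s'.var 5 = 1) s := by
  have hiB : i ≤ B := hi ▸ hs.1 3
  have h1 : i / (D * D) ≤ B := (Nat.div_le_self _ _).trans hiB
  refine wp_seq hB (wp_setVar hB hs ?_ fun hs₁ _ => wp_seq hB (wp_setVar hB hs₁ ?_ fun hs₂ _ =>
    wp_seq hB (wp_setVar hB hs₂ ?_ fun hs₃ _ => wp_seq hB (wp_setVar hB hs₃ ?_ fun hs₄ _ =>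
    wp_setVar hB hs₄ ?_ fun hs₅ => ?_))))
  · simp only [NExp.eval, hn, hD, hi]
    exact (Nat.div_le_self _ _).trans h1
  · simp only [NExp.eval, Function.update_apply]
    simp only [hn, hD, hi, Nat.reduceEqDiff, if_false]
    exact (Nat.mod_le _ _).trans h1
  · simp only [NExp.eval, Function.update_apply]
    simp only [hD, hi, Nat.reduceEqDiff, if_false]
    exact (Nat.mod_le _ _).trans ((Nat.div_le_self _ _).trans hiB)
  · simp only [NExp.eval, Function.update_apply]
    simp only [hD, hi, Nat.reduceEqDiff, if_false]
    exact (Nat.mod_le _ _).trans hiB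
  · simp only [NExp.eval]; omega
  · simp [NExp.eval, hn, hD, hi]

/-- Fill the table. -/
def tableProg : Prog :=
  .forLt 3 (.mul (.mul (.var 0) (.var 0)) (.mul (.var 2) (.var 2))) (.seq decodeProg cellProg)

theorem wp_table (hB : 2 ≤ B) (hs : s.Bdd B) {n p D : ℕ} {G S : ℕ → ℕ} {M V E : ℕ → ℂ}
    (hn : s.var 0 = n) (hp : s.var 1 = p) (hD : s.var 2 = D)
    (hG : s.arr 0 = G) (hS : s.arr 1 = S) (hM : s.num 0 = M) (hV : s.num 1 = V) (hE : s.num 2 = E)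
    (hpB : p ≤ B) (hpB' : 4 ^ p ≤ B) (hB' : n * n * (D * D) ≤ B) :
    WP B tableProg (fun s' => ∀ x, x < n * n * (D * D) → s'.num 4 x =
      initTable n p G S M V E (x / (D * D) / n) (x / (D * D) % n) (x / D % D) (x % D)) s := by
  refine wp_forLt hB hs (n * n * (D * D)) hB' (fun i s' => ∀ x, x < i → s'.num 4 x =
      initTable n p G S M V E (x / (D * D) / n) (x / (D * D) % n) (x / D % D) (x % D))
      (by decide) ?_ ?_ ?_ ?_ ?_
  · intro i s' a h; exact h
  · intro s' hf
    simp only [NExp.eval]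
    rw [hf.var 0 (by decide), hf.var 2 (by decide), hn, hD]
  · intro x hx; omega
  · intro i hi s' hs' hf h3 hI
    have e0 := (hf.var 0 (by decide)).trans hn
    have e1 := (hf.var 1 (by decide)).trans hp
    have e2 := (hf.var 2 (by decide)).trans hD
    refine wp_seq hB ((wp_decode hB hs' e0 e2 h3).mono fun s₁ _ hf₁ h hs₁ => ?_)
    obtain ⟨h12, h13, h14, h15, h5⟩ := h
    refine (wp_cell hB hs₁ ((hf₁.var 0 (by decide)).trans e0) ((hf₁.var 1 (by decide)).trans e1)
      ((hf₁.var 3 (by decide)).trans h3) h5 h12 h13 h14 h15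
      ((hf₁.arr 0 (by decide)).trans ((hf.arr 0 (by decide)).trans hG))
      ((hf₁.arr 1 (by decide)).trans ((hf.arr 1 (by decide)).trans hS))
      ((hf₁.num 0 (by decide)).trans ((hf.num 0 (by decide)).trans hM))
      ((hf₁.num 1 (by decide)).trans ((hf.num 1 (by decide)).trans hV))
      ((hf₁.num 2 (by decide)).trans ((hf.num 2 (by decide)).trans hE))
      hpB hpB').mono fun s₂ _ _ h x hx => ?_
    rw [h, Function.update_apply]
    split_ifs with hxi
    · rw [hxi]
    · rw [hf₁.num 4 (by decide)]
      exact hI x (by omega)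
  · intro s' _ _ h; exact h

/-! ## The elimination program -/

/-- The interactions stored in a table. -/
def readTable (n D : ℕ) (T : ℕ → ℂ) : ℕ → ℕ → ℕ → ℕ → ℂ := fun j k c d =>
  T ((j * n + k) * (D * D) + (c * D + d))

/-- The adjacency stored in an array. -/
def readAdj (n : ℕ) (G : ℕ → ℕ) : ℕ → ℕ → ℕ := fun j k => G (j * n + k)

/-! ### Mixed-radix addresses -/

theorem pair_lt {m x y : ℕ} (hx : x < m) (hy : y < m) : x * m + y < m * m := by
  have := Nat.mul_le_mul_right m (show x + 1 ≤ m from hx)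
  rw [add_mul, one_mul] at this
  omega

theorem pair_div {m x y : ℕ} (hy : y < m) : (x * m + y) / m = x := by
  rw [mul_comm, Nat.mul_add_div (by omega), Nat.div_eq_of_lt hy, add_zero]

theorem pair_mod {m x y : ℕ} (hy : y < m) : (x * m + y) % m = y := by
  rw [mul_comm, Nat.mul_add_mod, Nat.mod_eq_of_lt hy]

theorem pair_inj {m x y x' y' : ℕ} (hy : y < m) (hy' : y' < m) :
    x * m + y = x' * m + y' ↔ x = x' ∧ y = y' := by
  refine ⟨fun h => ⟨?_, ?_⟩, fun h => by rw [h.1, h.2]⟩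
  · rw [← pair_div (x := x) hy, h, pair_div hy']
  · rw [← pair_mod (x := x) hy, h, pair_mod hy']

/-- Membership in the block number `q` of length `m`. -/
theorem mem_block {m q x : ℕ} {y : ℕ} (hy : y < m) :
    q * m ≤ x * m + y ∧ x * m + y < q * m + m ↔ x = q := by
  constructor
  · rintro ⟨h1, h2⟩
    have h3 : q < x + 1 := by
      by_contra h
      have := Nat.mul_le_mul_right m (show x + 1 ≤ q by omega)
      rw [add_mul, one_mul] at this
      omega
    have h4 : x < q + 1 := by
      by_contra h
      have := Nat.mul_le_mul_right m (show q + 1 ≤ x by omega)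
      rw [add_mul, one_mul] at this
      omega
    omega
  · rintro rfl
    omega

/-- Find the first neighbour `u` and the last neighbour `w` of `v` below `v`. -/
def scanProg : Prog :=
  .seq (.setVar 8 (.const 0)) (.seq (.setVar 9 (.const 0)) (.forLt 10 (.var 7) (.seq
    (.ifLt (.const 0) (.load 0 (.add (.mul (.var 10) (.var 0)) (.var 7)))
      (.setVar 9 (.var 10)) .skip)
    (.ifLt (.const 0) (.load 0 (.add (.mul (.sub (.sub (.var 7) (.const 1)) (.var 10)) (.var 0))
        (.var 7)))
      (.setVar 8 (.sub (.sub (.var 7) (.const 1)) (.var 10))) .skip))))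

theorem IsLastBelow.succ_of_pos {q : ℕ → Prop} {i : ℕ} (hq : q i) : IsLastBelow q (i + 1) i :=
  .inl ⟨hq, by omega, fun k hk _ => by omega⟩

theorem IsLastBelow.succ_of_neg {q : ℕ → Prop} {i w : ℕ} (hq : ¬ q i) (h : IsLastBelow q i w) :
    IsLastBelow q (i + 1) w := by
  have hk : ∀ k, k < i + 1 → q k → k < i := fun k hk hqk =>
    lt_of_le_of_ne (by omega) fun h => hq (h ▸ hqk)
  rcases h with ⟨h1, h2, h3⟩ | ⟨h1, h3⟩
  · exact .inl ⟨h1, by omega, fun k hk' hqk => h3 k (hk k hk' hqk) hqk⟩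
  · exact .inr ⟨h1, fun k hk' hqk => h3 k (hk k hk' hqk) hqk⟩

theorem IsFirstFrom.pred_of_pos {q : ℕ → Prop} {v i : ℕ} (hq : q i) (hi : i < v) :
    IsFirstFrom q v i i :=
  .inl ⟨hq, hi, le_rfl, fun _ hk _ _ => hk⟩

theorem IsFirstFrom.pred_of_neg {q : ℕ → Prop} {v i u : ℕ} (hq : ¬ q i)
    (h : IsFirstFrom q v (i + 1) u) : IsFirstFrom q v i u := by
  have hk : ∀ k, i ≤ k → q k → i + 1 ≤ k := fun k hk hqk =>
    lt_of_le_of_ne hk fun h => hq (h ▸ hqk)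
  rcases h with ⟨h1, h2, h3, h4⟩ | ⟨h1, h4⟩
  · exact .inl ⟨h1, h2, by omega, fun k hk' hkv hqk => h4 k (hk k hk' hqk) hkv hqk⟩
  · exact .inr ⟨h1, fun k hk' hkv hqk => h4 k (hk k hk' hqk) hkv hqk⟩

/-- One loop performs both searches: the ascending index `i` overwrites `w` and the descending index
`v - 1 - i` overwrites `u`, so the last writes are the largest and the smallest neighbour. -/
theorem wp_scan (hB : 2 ≤ B) (hs : s.Bdd B) {n v : ℕ} (hn : s.var 0 = n) (hv : s.var 7 = v) :
    WP B scanProg (fun s' =>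
      IsLastBelow (fun k => 0 < readAdj n (s.arr 0) k v) v (s'.var 9) ∧
      IsFirstFrom (fun k => 0 < readAdj n (s.arr 0) k v) v 0 (s'.var 8)) s := by
  have hvB : v ≤ B := hv ▸ hs.1 7
  refine wp_seq hB (wp_setVar hB hs (by simp [NExp.eval]) fun hs₁ _ =>
    wp_seq hB (wp_setVar hB hs₁ (by simp [NExp.eval]) fun hs₂ _ => ?_))
  refine wp_forLt hB hs₂ v hvB (fun i s' =>
      IsLastBelow (fun k => 0 < readAdj n (s.arr 0) k v) i (s'.var 9) ∧
      IsFirstFrom (fun k => 0 < readAdj n (s.arr 0) k v) v (v - i) (s'.var 8))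
      (by decide) ?_ ?_ ?_ ?_ ?_
  · intro i s' a h
    simpa [Function.update_apply] using h
  · intro s' hf
    simp only [NExp.eval]
    rw [hf.var 7 (by decide)]
    simpa using hv
  · constructor
    · exact .inr ⟨by simp [NExp.eval], fun k hk => by omega⟩
    · exact .inr ⟨by simp [NExp.eval], fun k hk hk' => by omega⟩
  · intro i hi s' hs' hf h10 hI
    have e0 : s'.var 0 = n := (hf.var 0 (by decide)).trans (by simpa using hn)
    have e7 : s'.var 7 = v := (hf.var 7 (by decide)).trans (by simpa using hv)
    have f0 : s'.arr 0 = s.arr 0 := hf.arr 0 (by decide)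
    have hmid : WP B (.ifLt (.const 0) (.load 0 (.add (.mul (.var 10) (.var 0)) (.var 7)))
        (.setVar 9 (.var 10)) .skip) (fun s₁ =>
          IsLastBelow (fun k => 0 < readAdj n (s.arr 0) k v) (i + 1) (s₁.var 9)) s' := by
      refine wp_ifLt hB hs' (fun h => wp_setVar hB hs' ?_ fun _ => ?_)
        (fun h => wp_skip hB hs' ?_)
      · simp only [NExp.eval]; exact hs'.1 10
      · simp only [NExp.eval, e0, e7, h10, f0] at h
        simpa [NExp.eval, h10] using
          IsLastBelow.succ_of_pos (q := fun k => 0 < readAdj n (s.arr 0) k v) h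
      · simp only [NExp.eval, e0, e7, h10, f0] at h
        exact hI.1.succ_of_neg h
    refine wp_seq hB (hmid.mono fun s₁ _ hf₁ hL hs₁ => ?_)
    have g0 := (hf₁.var 0 (by decide)).trans e0
    have g7 := (hf₁.var 7 (by decide)).trans e7
    have g8 := hf₁.var 8 (by decide)
    have g10 := (hf₁.var 10 (by decide)).trans h10
    have k0 := (hf₁.arr 0 (by decide)).trans f0
    -- As `i < v`, no subtraction is truncated, and the searched window `[v - i, v)` grows by
    -- exactly `v - 1 - i`.
    have hvi : v - i = v - 1 - i + 1 := by omega
    have hvi' : v - (i + 1) = v - 1 - i := by omega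
    refine wp_ifLt hB hs₁ (fun h => wp_setVar hB hs₁ ?_ fun _ => ?_)
        (fun h => wp_skip hB hs₁ ?_)
    · simp only [NExp.eval, g7, g10]; omega
    · simp only [NExp.eval, g0, g7, g10, k0] at h
      refine ⟨by simpa using hL, ?_⟩
      simp only [NExp.eval, g7, g10, Function.update_self]
      rw [hvi']
      exact IsFirstFrom.pred_of_pos h (by omega)
    · simp only [NExp.eval, g0, g7, g10, k0] at h
      refine ⟨hL, ?_⟩
      rw [hvi', g8]
      exact IsFirstFrom.pred_of_neg h (hvi ▸ hI.2)
  · intro s' _ _ h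
    simpa using h

/-- Address of a table cell. -/
def cellExp (j k c d : NExp) : NExp :=
  .add (.mul (.add (.mul j (.var 0)) k) (.mul (.var 2) (.var 2))) (.add (.mul c (.var 2)) d)

/-- Compute the message of `v` to `u` and `w` for the states encoded in the table index. -/
def messageProg : Prog :=
  .seq (.setNum 3 (.const 0) (.const 0)) (.forLt 11 (.var 2) (.ifLt (.var 8) (.var 9)
    (.setNum 3 (.const 0) (.add (.load 3 (.const 0)) (.mul
      (.mul (.load 4 (cellExp (.var 7) (.var 7) (.var 11) (.var 11)))
        (.load 4 (cellExp (.var 8) (.var 7) (.div (.var 3) (.var 2)) (.var 11))))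
      (.load 4 (cellExp (.var 9) (.var 7) (.mod (.var 3) (.var 2)) (.var 11))))))
    (.setNum 3 (.const 0) (.add (.load 3 (.const 0))
      (.mul (.load 4 (cellExp (.var 7) (.var 7) (.var 11) (.var 11)))
        (.load 4 (cellExp (.var 8) (.var 7) (.div (.var 3) (.var 2)) (.var 11))))))))

theorem wp_message (hB : 2 ≤ B) (hs : s.Bdd B) {n D i v u w : ℕ} (hn : s.var 0 = n)
    (hD : s.var 2 = D) (hi : s.var 3 = i) (hv : s.var 7 = v) (hu : s.var 8 = u)
    (hw : s.var 9 = w) :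
    WP B messageProg (fun s' => s'.num 3 0 =
      message D (readTable n D (s.num 4)) v u w (i / D) (i % D)) s := by
  have hDB : D ≤ B := hD ▸ hs.1 2
  refine wp_seq hB (wp_setNum hB hs fun hs₁ => ?_)
  refine wp_forLt hB hs₁ D hDB (fun e s' => s'.num 3 0 =
      ∑ e ∈ Finset.range e, readTable n D (s.num 4) v v e e *
        readTable n D (s.num 4) u v (i / D) e *
        if u < w then readTable n D (s.num 4) w v (i % D) e else 1) (by decide) ?_ ?_ ?_ ?_ ?_
  · intro i s' a h; exact h
  · intro s' hf
    simp only [NExp.eval]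
    rw [hf.var 2 (by decide)]
    exact hD
  · simp [NExp.eval, CExp.eval]
  · intro e he s' hs' hf h11 hI
    have e0 : s'.var 0 = n := (hf.var 0 (by decide)).trans hn
    have e2 : s'.var 2 = D := (hf.var 2 (by decide)).trans hD
    have e3 : s'.var 3 = i := (hf.var 3 (by decide)).trans hi
    have e7 : s'.var 7 = v := (hf.var 7 (by decide)).trans hv
    have e8 : s'.var 8 = u := (hf.var 8 (by decide)).trans hu
    have e9 : s'.var 9 = w := (hf.var 9 (by decide)).trans hw
    have f4 : s'.num 4 = s.num 4 := (hf.num 4 (by decide)).trans (by simp)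
    refine wp_ifLt hB hs' (fun h => wp_setNum hB hs' ?_) (fun h => wp_setNum hB hs' ?_)
    · simp only [NExp.eval, e8, e9] at h
      simp only [NExp.eval, CExp.eval, Function.update_self, hI, cellExp, e0, e2, e3, e7, e8, e9,
        h11, f4, Finset.sum_range_succ, h, if_true, readTable]
    · simp only [NExp.eval, e8, e9] at h
      simp only [NExp.eval, CExp.eval, Function.update_self, hI, cellExp, e0, e2, e3, e7, e8,
        h11, f4, Finset.sum_range_succ, h, if_false, readTable, mul_one]
  · intro s' _ _ h; exact h

/-- Address of the cell of the pair `u`, `w` for the states encoded in the table index. -/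
def targetExp : NExp :=
  .add (.mul (.add (.mul (.var 8) (.var 0)) (.var 9)) (.mul (.var 2) (.var 2))) (.var 3)

/-- Multiply the interaction of `u` and `w` with the message of `v`. -/
def updateProg : Prog :=
  .forLt 3 (.mul (.var 2) (.var 2)) (.seq messageProg
    (.setNum 4 targetExp (.mul (.load 4 targetExp) (.load 3 (.const 0)))))

theorem readTable_congr_block {n D q : ℕ} {T T' : ℕ → ℂ} {j k c d : ℕ} (hc : c < D) (hd : d < D)
    (hne : j * n + k ≠ q)
    (h : ∀ x, ¬ (q * (D * D) ≤ x ∧ x < q * (D * D) + D * D) → T' x = T x) :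
    readTable n D T' j k c d = readTable n D T j k c d :=
  h _ fun hx => hne ((mem_block (pair_lt hc hd)).1 hx)

theorem message_congr {D v u w c d : ℕ} {F F' : ℕ → ℕ → ℕ → ℕ → ℂ} (hc : c < D) (hd : d < D)
    (h : ∀ j c e, (j = v ∨ j = u ∨ j = w) → c < D → e < D → F' j v c e = F j v c e) :
    message D F' v u w c d = message D F v u w c d := by
  refine Finset.sum_congr rfl fun e he => ?_
  have he := Finset.mem_range.1 he
  rw [h v e e (.inl rfl) he he, h u c e (.inr (.inl rfl)) hc he,
    h w d e (.inr (.inr rfl)) hd he]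

/-- The table is overwritten in place. The cells of the pair `(u, w)` form one contiguous block of
length `D * D`, while messages read only cells of pairs with second vertex `v > w`. Hence earlier
writes never disturb later messages. -/
theorem wp_update (hB : 2 ≤ B) (hs : s.Bdd B) {n D v u w : ℕ} (hn : s.var 0 = n)
    (hD : s.var 2 = D) (hv : s.var 7 = v) (hu : s.var 8 = u)
    (hw : s.var 9 = w) (hDB : D * D ≤ B) (hvn : v < n) (hwv : w < v) :
    WP B updateProg (fun s' => ∀ j k c d, j < n → k < n → c < D → d < D →
      readTable n D (s'.num 4) j k c d = elim D (readTable n D (s.num 4)) v u w j k c d) s := by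
  refine wp_forLt hB hs (D * D) hDB (fun i s' => ∀ x, s'.num 4 x =
      if (u * n + w) * (D * D) ≤ x ∧ x < (u * n + w) * (D * D) + i then
        s.num 4 x * message D (readTable n D (s.num 4)) v u w
          ((x - (u * n + w) * (D * D)) / D) ((x - (u * n + w) * (D * D)) % D)
      else s.num 4 x) (by decide) ?_ ?_ ?_ ?_ ?_
  · intro i s' a h; exact h
  · intro s' hf
    simp only [NExp.eval]
    rw [hf.var 2 (by decide), hD]
  · intro x
    rw [if_neg (by omega)]
  · intro i hi s' hs' hf h3 hI
    have e0 : s'.var 0 = n := (hf.var 0 (by decide)).trans hn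
    have e2 : s'.var 2 = D := (hf.var 2 (by decide)).trans hD
    have e7 : s'.var 7 = v := (hf.var 7 (by decide)).trans hv
    have e8 : s'.var 8 = u := (hf.var 8 (by decide)).trans hu
    have e9 : s'.var 9 = w := (hf.var 9 (by decide)).trans hw
    have hD0 : 0 < D := by
      rcases Nat.eq_zero_or_pos D with h | h
      · simp [h] at hi
      · exact h
    refine wp_seq hB ((wp_message hB hs' e0 e2 h3 e7 e8 e9).mono fun s₁ _ hf₁ h hs₁ => ?_)
    have hmsg : s₁.num 3 0 =
        message D (readTable n D (s.num 4)) v u w (i / D) (i % D) := by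
      rw [h]
      refine message_congr (Nat.div_lt_of_lt_mul hi) (Nat.mod_lt _ hD0) fun j c e _ hc he =>
        readTable_congr_block (q := u * n + w) hc he ?_ fun x hx => ?_
      · rw [Ne, pair_inj hvn (by omega)]; omega
      · rw [hI x, if_neg (by omega)]
    have g0 := (hf₁.var 0 (by decide)).trans e0
    have g2 := (hf₁.var 2 (by decide)).trans e2
    have g3 := (hf₁.var 3 (by decide)).trans h3
    have g8 := (hf₁.var 8 (by decide)).trans e8
    have g9 := (hf₁.var 9 (by decide)).trans e9
    have k4 := hf₁.num 4 (by decide)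
    refine wp_setNum hB hs₁ fun x => ?_
    simp only [targetExp, NExp.eval, CExp.eval, g0, g2, g3, g8, g9, k4, hmsg, Function.update_self]
    rw [Function.update_apply]
    generalize (u * n + w) * (D * D) = b at *
    split_ifs with h1 h2 h2
    · subst h1
      rw [hI, if_neg (by omega), Nat.add_sub_cancel_left]
    · omega
    · rw [hI, if_pos (by omega)]
    · rw [hI, if_neg (by omega)]
  · intro s' _ _ h j k c d hj hk hc hd
    have hb := mem_block (q := u * n + w) (x := j * n + k) (pair_lt hc hd)
    rw [pair_inj hk (by omega)] at hb
    by_cases hjk : j = u ∧ k = w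
    · rw [readTable, h, if_pos (hb.2 hjk), elim, if_pos hjk, hjk.1, hjk.2,
        Nat.add_sub_cancel_left, pair_div hd, pair_mod hd]
      rfl
    · rw [readTable, h, if_neg (fun h => hjk (hb.1 h)), elim, if_neg hjk]
      rfl

/-- Eliminate one vertex. -/
def elimProg : Prog :=
  .seq (.setVar 7 (.sub (.sub (.var 0) (.const 1)) (.var 6)))
    (.seq scanProg (.seq updateProg
      (.setArr 0 (.add (.mul (.var 8) (.var 0)) (.var 9)) (.const 1))))

theorem Eliminable.congr {D m : ℕ} {a a' : ℕ → ℕ → ℕ} {F F' : ℕ → ℕ → ℕ → ℕ → ℂ}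
    (h : Eliminable D m a F) (ha : ∀ j k, j < m → k < m → a' j k = a j k)
    (hF : ∀ j k c d, j < m → k < m → c < D → d < D → F' j k c d = F j k c d) :
    Eliminable D m a' F' := by
  refine ⟨fun j k c d hjk hk h0 hc hd => ?_, fun x hx => ?_⟩
  · rw [hF j k c d (by omega) hk hc hd]
    exact h.one j k c d hjk hk (by rw [← ha j k (by omega) hk, h0]) hc hd
  · convert h.card x hx using 2
    refine Finset.filter_congr fun k hk => ?_
    rw [ha k x (Finset.mem_range.1 hk) hx, ha x k hx (Finset.mem_range.1 hk)]

theorem wp_elim (hB : 2 ≤ B) (hs : s.Bdd B) {n D v : ℕ} (hn : s.var 0 = n)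
    (hD : s.var 2 = D) (h6 : n - 1 - s.var 6 = v) (hDB : D * D ≤ B) (hv : 0 < v) (hvn : v < n)
    (hE : Eliminable D (v + 1) (readAdj n (s.arr 0)) (readTable n D (s.num 4))) :
    WP B elimProg (fun s' => Eliminable D v (readAdj n (s'.arr 0)) (readTable n D (s'.num 4)) ∧
      partition D v (readTable n D (s'.num 4)) =
        partition D (v + 1) (readTable n D (s.num 4))) s := by
  have hnB : n ≤ B := hn ▸ hs.1 0
  refine wp_seq hB (wp_setVar hB hs ?_ fun hs₁ _ => wp_seq hB ?_)
  · simp only [NExp.eval, hn]; omega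
  refine (wp_scan hB hs₁ (n := n) (v := v) (by simpa using hn)
    (by simp [NExp.eval, hn, h6])).mono fun s₂ _ hf₂ h hs₂ => ?_
  obtain ⟨huw, hwv, hE', hpart⟩ := hE.elim hv h.1 h.2
  have e0 : s₂.var 0 = n := (hf₂.var 0 (by decide)).trans (by simpa using hn)
  have e2 : s₂.var 2 = D := (hf₂.var 2 (by decide)).trans (by simpa using hD)
  have e7 : s₂.var 7 = v := (hf₂.var 7 (by decide)).trans (by simp [NExp.eval, hn, h6])
  have f4 : s₂.num 4 = s.num 4 := hf₂.num 4 (by decide)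
  have f0 : s₂.arr 0 = s.arr 0 := hf₂.arr 0 (by decide)
  refine wp_seq hB ((wp_update hB hs₂ e0 e2 e7 rfl rfl hDB hvn hwv).mono
    fun s₃ _ hf₃ h3 hs₃ => ?_)
  have g0 : s₃.var 0 = n := (hf₃.var 0 (by decide)).trans e0
  have g8 : s₃.var 8 = s₂.var 8 := hf₃.var 8 (by decide)
  have g9 : s₃.var 9 = s₂.var 9 := hf₃.var 9 (by decide)
  have k0 : s₃.arr 0 = s.arr 0 := (hf₃.arr 0 (by decide)).trans f0
  rw [f4] at h3
  -- For `u = w` this write hits a diagonal entry of the adjacency table, which the elimination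
  -- never reads.
  refine wp_setArr hB hs₃ (by simp only [NExp.eval]; omega) ⟨hE'.congr ?_ ?_, ?_⟩
  · intro j k hj hk
    simp only [readAdj, NExp.eval, Function.update_self, g0, g8, g9, k0, Function.update_apply]
    simp only [pair_inj (show k < n by omega) (show s₂.var 9 < n by omega)]
  · intro j k c d hj hk hc hd
    exact h3 j k c d (by omega) (by omega) hc hd
  · rw [← hpart]
    exact partition_congr fun j k c d hjk hk hc hd => h3 j k c d (by omega) (by omega) hc hd

/-- Sum up the weights of the last vertex. -/
def finalProg : Prog :=
  .seq (.setNum 3 (.const 0) (.const 0)) (.forLt 11 (.var 2)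
    (.setNum 3 (.const 0) (.add (.load 3 (.const 0))
      (.load 4 (cellExp (.const 0) (.const 0) (.var 11) (.var 11))))))

theorem wp_final (hB : 2 ≤ B) (hs : s.Bdd B) {n D : ℕ} (hn : s.var 0 = n) (hD : s.var 2 = D) :
    WP B finalProg (fun s' => s'.num 3 0 = partition D 1 (readTable n D (s.num 4))) s := by
  have hDB : D ≤ B := hD ▸ hs.1 2
  rw [partition_one]
  refine wp_seq hB (wp_setNum hB hs fun hs₁ => ?_)
  refine wp_forLt hB hs₁ D hDB (fun e s' => s'.num 3 0 =
      ∑ e ∈ Finset.range e, readTable n D (s.num 4) 0 0 e e) (by decide) ?_ ?_ ?_ ?_ ?_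
  · intro i s' a h; exact h
  · intro s' hf
    simp only [NExp.eval]
    rw [hf.var 2 (by decide)]
    exact hD
  · simp [NExp.eval, CExp.eval]
  · intro e he s' hs' hf h11 hI
    have e0 : s'.var 0 = n := (hf.var 0 (by decide)).trans hn
    have e2 : s'.var 2 = D := (hf.var 2 (by decide)).trans hD
    have f4 : s'.num 4 = s.num 4 := (hf.num 4 (by decide)).trans (by simp)
    refine wp_setNum hB hs' ?_
    simp only [NExp.eval, CExp.eval, Function.update_self, hI, cellExp, e0, e2,
        h11, f4, Finset.sum_range_succ, readTable]
  · intro s' _ _ h; exact h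

/-- The whole simulation. -/
def simulationProg : Prog :=
  .seq stateCountProg (.seq tableProg (.seq
    (.forLt 6 (.sub (.var 0) (.const 1)) elimProg) finalProg))

theorem readTable_decode {n p D : ℕ} {G S : ℕ → ℕ} {M V E T : ℕ → ℂ}
    (h : ∀ x, x < n * n * (D * D) → T x =
      initTable n p G S M V E (x / (D * D) / n) (x / (D * D) % n) (x / D % D) (x % D))
    {j k c d : ℕ} (hj : j < n) (hk : k < n) (hc : c < D) (hd : d < D) :
    readTable n D T j k c d = initTable n p G S M V E j k c d := by
  have h1 := pair_lt hj hk
  have h2 := pair_lt hc hd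
  rw [readTable, h]
  · rw [pair_div h2, pair_div hk, pair_mod hk]
    -- In Horner form, division and remainder by `D` strip off `d` and then `c`.
    have e : (j * n + k) * (D * D) + (c * D + d) = ((j * n + k) * D + c) * D + d := by ring
    rw [e, pair_div hd, pair_mod hd, pair_mod hc]
  · have := Nat.mul_le_mul_right (D * D) (show j * n + k + 1 ≤ n * n from h1)
    rw [add_mul, one_mul] at this
    omega

theorem wp_simulation (hB : 2 ≤ B) (hs : s.Bdd B) {n p D : ℕ} {G S : ℕ → ℕ} {M V E : ℕ → ℂ}
    (hn0 : 0 < n) (hDp : D = 4 ^ (p + 1)) (hn : s.var 0 = n) (hp : s.var 1 = p)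
    (hG : s.arr 0 = G) (hS : s.arr 1 = S) (hM : s.num 0 = M) (hV : s.num 1 = V) (hE : s.num 2 = E)
    (hB' : n * n * (D * D) ≤ B)
    (hdeg : Eliminable D n (readAdj n G) (initTable n p G S M V E)) :
    WP B simulationProg (fun s' => s'.num 3 0 = partition D n (initTable n p G S M V E)) s := by
  have hDD : D * D ≤ B := le_trans (Nat.le_mul_of_pos_left _ (by positivity)) hB'
  have hD1 : D ≤ B := le_trans (Nat.le_mul_self D) hDD
  have hpB' : 4 ^ p ≤ B := le_trans (by rw [hDp, pow_succ]; omega) hD1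
  have hpB : p ≤ B := le_trans (Nat.lt_pow_self (by norm_num)).le hpB'
  refine wp_seq hB ((wp_stateCount hB hs hp hpB (hDp ▸ hD1)).mono fun s₁ _ hf₁ h2 hs₁ => ?_)
  rw [← hDp] at h2
  have e0 := (hf₁.var 0 (by decide)).trans hn
  refine wp_seq hB ((wp_table hB hs₁ e0 ((hf₁.var 1 (by decide)).trans hp) h2
    ((hf₁.arr 0 (by decide)).trans hG) ((hf₁.arr 1 (by decide)).trans hS)
    ((hf₁.num 0 (by decide)).trans hM) ((hf₁.num 1 (by decide)).trans hV)
    ((hf₁.num 2 (by decide)).trans hE) hpB hpB' hB').mono fun s₂ _ hf₂ hT hs₂ => ?_)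
  have g0 := (hf₂.var 0 (by decide)).trans e0
  have g2 := (hf₂.var 2 (by decide)).trans h2
  have k0 : s₂.arr 0 = G := (hf₂.arr 0 (by decide)).trans ((hf₁.arr 0 (by decide)).trans hG)
  have hnB : n ≤ B := hn ▸ hs.1 0
  -- Invariant: after `r` rounds the first `n - r` vertices remain, with unchanged partition
  -- function. After `n - 1` rounds a single vertex is left.
  refine wp_seq hB (wp_forLt hB hs₂ (n - 1) (by omega) (fun r s' =>
    Eliminable D (n - r) (readAdj n (s'.arr 0)) (readTable n D (s'.num 4)) ∧
      partition D (n - r) (readTable n D (s'.num 4)) =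
        partition D n (initTable n p G S M V E)) (by decide) ?_ ?_ ?_ ?_ ?_)
  · intro i s' a h; exact h
  · intro s' hf
    simp only [NExp.eval]
    rw [hf.var 0 (by decide), g0]
  · refine ⟨hdeg.congr (fun j k _ _ => by rw [k0]) fun j k c d hj hk hc hd =>
      readTable_decode hT hj hk hc hd, partition_congr fun j k c d hjk hk hc hd =>
      readTable_decode hT (by omega) hk hc hd⟩
  · intro r hr s' hs' hf h6 hI
    have hv : n - r = n - 1 - r + 1 := by omega
    rw [hv] at hI
    refine (wp_elim hB hs' ((hf.var 0 (by decide)).trans g0) ((hf.var 2 (by decide)).trans g2)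
      (by rw [h6]) hDD (by omega) (by omega) hI.1).mono fun s₄ _ _ h => ?_
    rw [show n - (r + 1) = n - 1 - r by omega]
    exact ⟨h.1, h.2.trans hI.2⟩
  · intro s' hs' hf hI _
    rw [show n - (n - 1) = 1 by omega] at hI
    refine (wp_final hB hs' ((hf.var 0 (by decide)).trans g0)
      ((hf.var 2 (by decide)).trans g2)).mono fun s₄ _ _ h => ?_
    rw [h, hI.2]

/-! ## Decomposition of the cost function -/

theorem flipBit_flipBit {n : ℕ} (j : Fin n) (x : Fin n → Fin 2) : flipBit j (flipBit j x) = x := by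
  have h : ∀ a : Fin 2, a + 1 + 1 = a := by decide
  funext k
  by_cases hk : k = j
  · subst hk; simp [flipBit, h]
  · simp [flipBit, hk]

theorem eq_flipBit_comm {n : ℕ} (j : Fin n) (x y : Fin n → Fin 2) :
    x = flipBit j y ↔ flipBit j x = y :=
  ⟨fun h => by rw [h, flipBit_flipBit], fun h => by rw [← h, flipBit_flipBit]⟩

theorem flipBit_comm {n : ℕ} (j k : Fin n) (x : Fin n → Fin 2) :
    flipBit j (flipBit k x) = flipBit k (flipBit j x) := by
  by_cases h : j = k
  · rw [h]
  · have h' : k ≠ j := fun e => h e.symm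
    simp only [flipBit, Function.update_of_ne h, Function.update_of_ne h']
    exact (Function.update_comm h _ _ _).symm

/-- Change the differing coordinates one at a time: changing a bit is flipping it, and flipping an
irrelevant bit keeps the value. The induction runs over a set `T` that contains all coordinates
where `x` and `y` may differ. -/
theorem eq_of_agree_on_relevantVars {n : ℕ} {f : (Fin n → Fin 2) → ℝ} {x y : Fin n → Fin 2}
    (h : ∀ j ∈ relevantVars f, x j = y j) : f x = f y := by
  have key : ∀ (T : Finset (Fin n)) (x : Fin n → Fin 2), (∀ j, j ∉ T → x j = y j) →
      (∀ j ∈ T, j ∉ relevantVars f) → f x = f y := by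
    intro T
    induction T using Finset.induction_on with
    | empty => intro x hx _; rw [funext fun j => hx j (by simp)]
    | insert a T _ ih =>
      intro x hx hT
      have hT' : ∀ j ∈ T, j ∉ relevantVars f := fun j hj => hT j (Finset.mem_insert_of_mem hj)
      by_cases ha : x a = y a
      · refine ih x (fun j hj => ?_) hT'
        by_cases hja : j = a
        · rw [hja, ha]
        · exact hx j (by simp [hja, hj])
      · have hfa : f (flipBit a x) = f x := by
          have := hT a (Finset.mem_insert_self a T)
          simp only [relevantVars, Finset.mem_filter, Finset.mem_univ, true_and, not_exists,
            not_not] at this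
          exact this x
        rw [← hfa]
        refine ih _ (fun j hj => ?_) hT'
        by_cases hja : j = a
        · subst hja
          have h2 : ∀ u v : Fin 2, u ≠ v → u + 1 = v := by decide
          simpa [flipBit] using h2 _ _ ha
        · simpa [flipBit, hja] using hx j (by simp [hja, hj])
  refine key (Finset.univ.filter fun j => j ∉ relevantVars f) x (fun j hj => h j ?_)
    (fun j hj => by simpa using hj)
  simpa using hj

/-- The number of relevant variables selects the one summand that can survive, and irrelevant
coordinates may be set to `0`. The order `j < k` prevents counting a pair twice. -/
theorem twoLocal_decomposition {n : ℕ} {f : (Fin n → Fin 2) → ℝ}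
    (hf : (relevantVars f).card ≤ 2) (x : Fin n → Fin 2) :
    f x = (if relevantVars f = ∅ then f 0 else 0) +
      (∑ j, if relevantVars f = {j} then f (Function.update 0 j (x j)) else 0) +
      ∑ j, ∑ k, if j < k then (if relevantVars f = {j, k} then
        f (Function.update (Function.update 0 j (x j)) k (x k)) else 0) else 0 := by
  have hc : (relevantVars f).card = 0 ∨ (relevantVars f).card = 1 ∨ (relevantVars f).card = 2 := by
    omega
  have hpair : ∀ j k : Fin n, j < k → ({j, k} : Finset (Fin n)).card = 2 := fun j k h =>
    Finset.card_pair h.ne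
  rcases hc with hc | hc | hc
  · rw [Finset.card_eq_zero] at hc
    have h1 : ∀ j : Fin n, (∅ : Finset (Fin n)) ≠ {j} := fun j h => by simp at h
    have h2 : ∀ j k : Fin n, (∅ : Finset (Fin n)) ≠ {j, k} := fun j k h => by
      have : j ∈ (∅ : Finset (Fin n)) := by rw [h]; simp
      simp at this
    simp only [hc, h1, h2, if_true, if_false, Finset.sum_const_zero, add_zero, ite_self]
    exact eq_of_agree_on_relevantVars (by simp [hc])
  · obtain ⟨a, ha⟩ := Finset.card_eq_one.1 hc
    have h1 : ({a} : Finset (Fin n)) ≠ ∅ := by simp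
    have h2 : ∀ j k : Fin n, j < k → ({a} : Finset (Fin n)) ≠ {j, k} := fun j k hjk h => by
      have := hpair j k hjk
      rw [← h] at this
      simp at this
    have h3 : ∀ j k : Fin n, (if j < k then (if ({a} : Finset (Fin n)) = {j, k} then
        f (Function.update (Function.update 0 j (x j)) k (x k)) else 0) else 0) = 0 := by
      intro j k
      split_ifs with h h'
      · exact absurd h' (h2 j k h)
      · rfl
      · rfl
    simp only [ha, h1, h3, if_false, Finset.sum_const_zero, add_zero, zero_add,
      Finset.singleton_inj, Finset.sum_ite_eq, Finset.mem_univ, if_true]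
    exact eq_of_agree_on_relevantVars (by simp [ha])
  · obtain ⟨a, b, hab, hr⟩ : ∃ a b : Fin n, a < b ∧ relevantVars f = {a, b} := by
      obtain ⟨a, b, hab, h⟩ := Finset.card_eq_two.1 hc
      rcases lt_or_gt_of_ne hab with h' | h'
      · exact ⟨a, b, h', h⟩
      · exact ⟨b, a, h', by rw [h, Finset.pair_comm]⟩
    have h1 : ({a, b} : Finset (Fin n)) ≠ ∅ := by simp
    have h2 : ∀ j : Fin n, ({a, b} : Finset (Fin n)) ≠ {j} := fun j h => by
      have := hpair a b hab
      rw [h] at this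
      simp at this
    have h3 : ∀ j k : Fin n, (if j < k then (if ({a, b} : Finset (Fin n)) = {j, k} then
        f (Function.update (Function.update 0 j (x j)) k (x k)) else 0) else 0) =
        if a = j then (if b = k then
          f (Function.update (Function.update 0 a (x a)) b (x b)) else 0) else 0 := by
      intro j k
      by_cases hj : a = j
      · by_cases hk : b = k
        · subst hj hk; simp [hab]
        · subst hj
          rw [if_pos rfl, if_neg hk]
          split_ifs with h h'
          · have : k ∈ ({a, b} : Finset (Fin n)) := by rw [h']; simp
            simp only [Finset.mem_insert, Finset.mem_singleton] at this
            rcases this with e | e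
            · exact absurd e h.ne'
            · exact absurd e.symm hk
          · rfl
          · rfl
      · rw [if_neg hj]
        split_ifs with h h'
        · exfalso
          have e1 : a ∈ ({j, k} : Finset (Fin n)) := by rw [← h']; simp
          have e2 : j ∈ ({a, b} : Finset (Fin n)) := by rw [h']; simp
          simp only [Finset.mem_insert, Finset.mem_singleton] at e1 e2
          rcases e1 with e1 | e1
          · exact hj e1
          · rcases e2 with e2 | e2
            · exact hj e2.symm
            · rw [e2] at h; rw [e1] at hab; exact lt_asymm h hab
        · rfl
        · rfl
    simp only [hr, h1, h2, h3, if_false, Finset.sum_const_zero, zero_add, Finset.sum_ite_irrel,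
      Finset.sum_ite_eq, Finset.mem_univ, if_true]
    refine eq_of_agree_on_relevantVars fun j hj => ?_
    rw [hr] at hj
    simp only [Finset.mem_insert, Finset.mem_singleton] at hj
    rcases hj with rfl | rfl
    · rw [Function.update_of_ne hab.ne]; simp
    · simp

namespace Instance

variable {n p : ℕ} (Q : Instance n p)

/-- Total value of the constant terms. -/
noncomputable def constCost : ℝ := ∑ i with relevantVars (Q.term i) = ∅, Q.term i 0

theorem cost_eq (x : Fin n → Fin 2) :
    Q.cost x = Q.constCost + (∑ j, Q.vertexCost j (x j)) +
      ∑ j, ∑ k, if j < k then Q.edgeCost j k (x j) (x k) else 0 := by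
  rw [cost, Finset.sum_congr rfl fun i _ => twoLocal_decomposition (Q.two_local i) x,
    Finset.sum_add_distrib, Finset.sum_add_distrib, Finset.sum_comm]
  congr 1
  · congr 1
    · rw [constCost, Finset.sum_filter]
    · exact Finset.sum_congr rfl fun j _ => by rw [vertexCost, Finset.sum_filter]
  · rw [Finset.sum_comm]
    refine Finset.sum_congr rfl fun j _ => ?_
    rw [Finset.sum_comm]
    refine Finset.sum_congr rfl fun k _ => ?_
    split_ifs with h
    · rw [edgeCost, Finset.sum_filter]
    · simp

theorem edgeGate_of_not_adj {j k : Fin n} (hjk : j ≠ k) (h : ¬ Q.interactionGraph.Adj j k)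
    (l : Fin p) (a b : Fin 2) : Q.edgeGate l j k a b = 1 := by
  have : Q.edgeCost j k a b = 0 := by
    rw [edgeCost, Finset.sum_filter]
    refine Finset.sum_eq_zero fun i _ => if_neg fun hi => h ⟨hjk, i, ?_, ?_⟩
    · rw [hi]; simp
    · rw [hi]; simp
  simp [edgeGate, this]

/-- The product of the gates of a phase layer. -/
noncomputable def phaseProd (l : Fin p) (x : Fin n → Fin 2) : ℂ :=
  (∏ j, Q.vertexGate l j (x j)) *
    ∏ j, ∏ k, if j < k then Q.edgeGate l j k (x j) (x k) else 1

/-- The global phase of a phase layer. -/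
noncomputable def globalPhase (l : Fin p) : ℂ :=
  Complex.exp (-(Complex.I * (Q.γ l : ℂ)) * (Q.constCost : ℂ))

/-- The exponent is purely imaginary. This is why constant terms of the cost drop out of every
product of an amplitude with a conjugate amplitude. -/
theorem globalPhase_mul_conj (l : Fin p) :
    Q.globalPhase l * (starRingEnd ℂ) (Q.globalPhase l) = 1 := by
  rw [globalPhase, ← Complex.exp_conj, ← Complex.exp_add]
  simp

theorem phaseLayer_eq (l : Fin p) :
    Q.phaseLayer l = Matrix.diagonal fun x => Q.globalPhase l * Q.phaseProd l x := by
  rw [phaseLayer, costOp, ← Matrix.diagonal_smul, Matrix.exp_diagonal]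
  congr 1
  funext x
  rw [Pi.coe_exp, ← Complex.exp_eq_exp_ℂ, Pi.smul_apply, smul_eq_mul, Q.cost_eq x]
  push_cast
  rw [mul_add, mul_add, Complex.exp_add, Complex.exp_add, Finset.mul_sum, Finset.mul_sum,
    Complex.exp_sum, Complex.exp_sum, mul_assoc]
  rw [globalPhase, phaseProd]
  congr 2
  refine Finset.prod_congr rfl fun j _ => ?_
  rw [Finset.mul_sum, Complex.exp_sum]
  refine Finset.prod_congr rfl fun k _ => ?_
  split_ifs
  · rfl
  · simp

end Instance

/-! ## The mixing layer -/

/-- The exponential of a multiple of an involution. -/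
theorem exp_smul_of_mul_self_eq_one {A : Type*} [NormedRing A] [NormedAlgebra ℂ A]
    [CompleteSpace A] {X : A} (hX : X * X = 1) (c : ℂ) :
    NormedSpace.exp (c • X) = Complex.cosh c • (1 : A) + Complex.sinh c • X := by
  -- `(1 + X) / 2` and `(1 - X) / 2` are orthogonal idempotents with sum `1`. They define a
  -- continuous ring homomorphism `φ` from `ℂ × ℂ` that sends `(c, -c)` to `c • X`, so the
  -- exponential can be computed coordinatewise.
  have e1 : (1 + X) * (1 + X) = (2 : ℂ) • (1 + X) := by
    rw [mul_add, add_mul, add_mul, hX, two_smul]; simp; abel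
  have e2 : (1 - X) * (1 - X) = (2 : ℂ) • (1 - X) := by
    rw [mul_sub, sub_mul, sub_mul, hX, two_smul]; simp; abel
  have e3 : (1 + X) * (1 - X) = 0 := by rw [mul_sub, add_mul, add_mul, hX]; simp; abel
  have e4 : (1 - X) * (1 + X) = 0 := by rw [mul_add, sub_mul, sub_mul, hX]; simp
  let φ : ℂ × ℂ →+* A :=
    { toFun := fun z => (z.1 / 2) • (1 + X) + (z.2 / 2) • (1 - X)
      map_one' := by simp only [Prod.fst_one, Prod.snd_one]; module
      map_zero' := by simp
      map_add' := fun z w => by simp only [Prod.fst_add, Prod.snd_add]; module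
      map_mul' := fun z w => by
        simp only [Prod.fst_mul, Prod.snd_mul, mul_add, add_mul, smul_mul_smul_comm, e1, e2, e3,
          e4]
        module }
  have hφ : Continuous φ := by
    change Continuous fun z : ℂ × ℂ => (z.1 / 2) • (1 + X) + (z.2 / 2) • (1 - X)
    fun_prop
  let _ : Algebra ℚ A := Algebra.compHom A (algebraMap ℚ ℂ)
  have h := NormedSpace.map_exp φ hφ (c, -c)
  have h1 : φ (c, -c) = c • X := by
    change (c / 2) • (1 + X) + (-c / 2) • (1 - X) = _
    module
  rw [h1] at h
  rw [← h]
  change ((NormedSpace.exp (c, -c)).1 / 2) • (1 + X) +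
    ((NormedSpace.exp (c, -c)).2 / 2) • (1 - X) = _
  rw [Prod.fst_exp, Prod.snd_exp, ← Complex.exp_eq_exp_ℂ, Complex.cosh, Complex.sinh]
  module

open scoped Matrix.Norms.Operator in
theorem matrix_exp_smul_of_mul_self_eq_one {m : Type*} [Fintype m] [DecidableEq m]
    {X : Matrix m m ℂ} (hX : X * X = 1) (c : ℂ) :
    NormedSpace.exp (c • X) = Complex.cosh c • (1 : Matrix m m ℂ) + Complex.sinh c • X :=
  exp_smul_of_mul_self_eq_one hX c

namespace Instance

variable {n p : ℕ}

theorem pauliXAt_mul (j : Fin n) (M : Matrix (Fin n → Fin 2) (Fin n → Fin 2) ℂ)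
    (x y : Fin n → Fin 2) : (pauliXAt j * M) x y = M (flipBit j x) y := by
  simp [Matrix.mul_apply, pauliXAt, eq_flipBit_comm]

theorem pauliXAt_mul_self (j : Fin n) : pauliXAt j * pauliXAt j = 1 := by
  ext x y
  rw [pauliXAt_mul]
  simp [pauliXAt, Matrix.one_apply, eq_flipBit_comm, flipBit_flipBit]

theorem pauliXAt_commute (j k : Fin n) : Commute (pauliXAt j) (pauliXAt k) := by
  ext x y
  rw [pauliXAt_mul, pauliXAt_mul]
  simp only [pauliXAt, Matrix.of_apply, eq_flipBit_comm, flipBit_comm j k]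

/-- Bit flips of different qubits commute, so the exponential of the sum is a product of
exponentials, each of the form `cosh c + sinh c • X_j` and acting on one coordinate only. Inducting
over subsets `T` lets the qubits outside `T` carry the identity. -/
theorem exp_smul_sum_pauliXAt (c : ℂ) (T : Finset (Fin n)) (x y : Fin n → Fin 2) :
    NormedSpace.exp (c • ∑ j ∈ T, pauliXAt j) x y =
      ∏ j, if j ∈ T then NormedSpace.exp (c • pauliX) (x j) (y j)
        else if x j = y j then 1 else 0 := by
  have hX : pauliX * pauliX = 1 := by
    ext a b; fin_cases a <;> fin_cases b <;> simp [pauliX]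
  induction T using Finset.induction_on generalizing x with
  | empty =>
    simp only [Finset.sum_empty, smul_zero, NormedSpace.exp_zero, Matrix.one_apply,
      Finset.notMem_empty, if_false]
    by_cases h : x = y
    · simp [h]
    · obtain ⟨j, hj⟩ := Function.ne_iff.1 h
      rw [if_neg h, Finset.prod_eq_zero (Finset.mem_univ j)]
      rw [if_neg hj]
  | insert a T ha ih =>
    rw [Finset.sum_insert ha, smul_add, Matrix.exp_add_of_commute,
      matrix_exp_smul_of_mul_self_eq_one (pauliXAt_mul_self a), add_mul, Matrix.add_apply,
      smul_mul_assoc, smul_mul_assoc, one_mul, Matrix.smul_apply, Matrix.smul_apply,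
      pauliXAt_mul, ih, ih]
    · rw [← Finset.mul_prod_erase _ _ (Finset.mem_univ a),
        ← Finset.mul_prod_erase _ _ (Finset.mem_univ a),
        ← Finset.mul_prod_erase _ _ (Finset.mem_univ a)]
      have h1 : ∀ j ∈ Finset.univ.erase a, (if j ∈ T then
          NormedSpace.exp (c • pauliX) (flipBit a x j) (y j)
          else if flipBit a x j = y j then 1 else 0) = if j ∈ T then
          NormedSpace.exp (c • pauliX) (x j) (y j) else if x j = y j then 1 else 0 := by
        intro j hj
        rw [flipBit, Function.update_of_ne (Finset.ne_of_mem_erase hj)]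
      have h2 : ∀ j ∈ Finset.univ.erase a, (if j ∈ insert a T then
          NormedSpace.exp (c • pauliX) (x j) (y j) else if x j = y j then 1 else 0) =
          if j ∈ T then
          NormedSpace.exp (c • pauliX) (x j) (y j) else if x j = y j then 1 else 0 := by
        intro j hj
        simp only [Finset.mem_insert, Finset.ne_of_mem_erase hj, false_or]
      rw [Finset.prod_congr rfl h1, Finset.prod_congr rfl h2]
      generalize (∏ j ∈ Finset.univ.erase a, _ : ℂ) = R
      simp only [ha, if_false, Finset.mem_insert_self, if_true,
        matrix_exp_smul_of_mul_self_eq_one hX, flipBit, Function.update_self]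
      generalize x a = u
      generalize y a = v
      fin_cases u <;> fin_cases v <;> simp [pauliX]
    · exact ((Commute.sum_right _ _ _ fun k _ => pauliXAt_commute a k).smul_left c).smul_right c

theorem mixLayer_apply (Q : Instance n p) (l : Fin p) (x y : Fin n → Fin 2) :
    Q.mixLayer l x y = ∏ j, Q.mixGate l (x j) (y j) := by
  rw [mixLayer, mixing, exp_smul_sum_pauliXAt]
  simp [mixGate]

end Instance

/-! ## The sum over histories -/

/-- A matrix product as a sum over paths. A path has `p + 1` points because it includes the state
before the first layer; the induction splits off the last point. -/
theorem foldl_mulVec_eq_sum {X : Type*} [Fintype X] [DecidableEq X] {p : ℕ}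
    (M : Fin p → Matrix X X ℂ) (v : X → ℂ) (x : X) :
    Fin.foldl p (fun ψ l => (M l).mulVec ψ) v x = ∑ y : Fin (p + 1) → X,
      if y (Fin.last p) = x then v (y 0) * ∏ l : Fin p, M l (y l.succ) (y l.castSucc) else 0 := by
  induction p generalizing x with
  | zero =>
    rw [Fin.foldl_zero, ← (Equiv.funUnique (Fin 1) X).symm.sum_comp]
    simp
  | succ p ih =>
    rw [Fin.foldl_succ_last, ← (Fin.snocEquiv fun _ : Fin (p + 1 + 1) => X).sum_comp,
      Fintype.sum_prod_type, Matrix.mulVec, dotProduct]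
    simp only [ih]
    simp only [Fin.snocEquiv_apply, Fin.snoc_last, Finset.sum_ite_irrel, Finset.sum_const_zero,
      Finset.sum_ite_eq', Finset.mem_univ, if_true]
    simp only [Finset.mul_sum]
    rw [Finset.sum_comm]
    refine Finset.sum_congr rfl fun y _ => ?_
    simp only [mul_ite, mul_zero, Finset.sum_ite_eq, Finset.mem_univ, if_true]
    have h0 : (Fin.snoc y x : Fin (p + 1 + 1) → X) 0 = y 0 :=
      Fin.snoc_castSucc (α := fun _ => X) x y 0
    rw [Fin.prod_univ_castSucc, h0]
    simp only [Fin.snoc_castSucc, ← Fin.castSucc_succ, Fin.succ_last, Fin.snoc_last]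
    ring

namespace Instance

variable {n p : ℕ} (Q : Instance n p)

/-- The amplitude of a history. -/
noncomputable def histWeight (y : Fin (p + 1) → Fin n → Fin 2) : ℂ :=
  plusState n (y 0) * ∏ l : Fin p, (∏ j, Q.mixGate l (y l.succ j) (y l.castSucc j)) *
    (Q.globalPhase l * Q.phaseProd l (y l.castSucc))

theorem outputState_eq (x : Fin n → Fin 2) : Q.outputState x =
    ∑ y : Fin (p + 1) → Fin n → Fin 2, if y (Fin.last p) = x then Q.histWeight y else 0 := by
  have h : Q.outputState =
      Fin.foldl p (fun ψ l => (Q.mixLayer l * Q.phaseLayer l).mulVec ψ) (plusState n) := by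
    simp only [outputState, Matrix.mulVec_mulVec]
  rw [h, foldl_mulVec_eq_sum]
  refine Finset.sum_congr rfl fun y _ => ?_
  simp only [histWeight, phaseLayer_eq, Matrix.mul_diagonal, mixLayer_apply]

/-- Each `‖ψ x‖ ^ 2` is a double sum over histories ending in `x`; summing over `x` leaves only the
condition that the two end points coincide and fit the event. -/
theorem marginal_eq (S : Finset (Fin n)) (z : S → Fin 2) :
    (Q.marginal S z : ℂ) = ∑ y : Fin (p + 1) → Fin n → Fin 2, ∑ y' : Fin (p + 1) → Fin n → Fin 2,
      if y (Fin.last p) = y' (Fin.last p) ∧ ∀ j : S, y (Fin.last p) j = z j then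
        Q.histWeight y * (starRingEnd ℂ) (Q.histWeight y') else 0 := by
  rw [marginal]
  push_cast
  simp only [← Complex.mul_conj', outputState_eq, map_sum, Finset.sum_mul_sum]
  have h : ∀ (q : Prop) [Decidable q] (A : (Fin (p + 1) → Fin n → Fin 2) →
      (Fin (p + 1) → Fin n → Fin 2) → ℂ), (if q then ∑ y, ∑ y', A y y' else 0) =
      ∑ y, ∑ y', if q then A y y' else 0 := fun q _ A => by split_ifs <;> simp
  rw [Finset.sum_filter, Finset.sum_congr rfl fun x _ => h _ _, Finset.sum_comm]
  refine Finset.sum_congr rfl fun y _ => ?_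
  rw [Finset.sum_comm]
  refine Finset.sum_congr rfl fun y' _ => ?_
  rw [Finset.sum_eq_single (y (Fin.last p))]
  · by_cases h1 : y (Fin.last p) = y' (Fin.last p)
    · simp [h1]
    · simp [h1, Ne.symm h1]
  · intro x _ hx
    simp [hx.symm]
  · simp

end Instance
variable {n p : ℕ} (Q : Instance n p)

/-! ## Reading the input arrays -/

theorem mixArray_apply (l : Fin p) (a b : Fin 2) :
    mixArray Q (((l : ℕ) * 2 + a) * 2 + b) = Q.mixGate l a b := by
  have hinj : Function.Injective
      fun q : Fin p × Fin 2 × Fin 2 => ((q.1 : ℕ) * 2 + q.2.1) * 2 + q.2.2 := by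
    rintro ⟨l, a, b⟩ ⟨l', a', b'⟩ h
    simp only [pair_inj b.2 b'.2, pair_inj a.2 a'.2] at h
    obtain ⟨⟨h1, h2⟩, h3⟩ := h
    rw [Fin.ext h1, Fin.ext h2, Fin.ext h3]
  exact hinj.extend_apply _ _ (l, a, b)

theorem vertexArray_apply (l : Fin p) (j : Fin n) (a : Fin 2) :
    vertexArray Q (((l : ℕ) * n + j) * 2 + a) = Q.vertexGate l j a := by
  have hinj : Function.Injective
      fun q : Fin p × Fin n × Fin 2 => ((q.1 : ℕ) * n + q.2.1) * 2 + q.2.2 := by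
    rintro ⟨l, j, a⟩ ⟨l', j', a'⟩ h
    simp only [pair_inj a.2 a'.2, pair_inj j.2 j'.2] at h
    obtain ⟨⟨h1, h2⟩, h3⟩ := h
    rw [Fin.ext h1, Fin.ext h2, Fin.ext h3]
  exact hinj.extend_apply _ _ (l, j, a)

theorem edgeArray_apply {j k : Fin n} (h : Q.interactionGraph.Adj j k) (l : Fin p) (a b : Fin 2) :
    edgeArray Q (((((l : ℕ) * n + j) * n + k) * 2 + a) * 2 + b) = Q.edgeGate l j k a b := by
  have hinj : Function.Injective fun q : Fin p × Fin n × Fin n × Fin 2 × Fin 2 =>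
      ((((q.1 : ℕ) * n + q.2.1) * n + q.2.2.1) * 2 + q.2.2.2.1) * 2 + q.2.2.2.2 := by
    rintro ⟨l, j, k, a, b⟩ ⟨l', j', k', a', b'⟩ h
    simp only [pair_inj b.2 b'.2, pair_inj a.2 a'.2, pair_inj k.2 k'.2, pair_inj j.2 j'.2] at h
    obtain ⟨⟨⟨⟨h1, h2⟩, h3⟩, h4⟩, h5⟩ := h
    rw [Fin.ext h1, Fin.ext h2, Fin.ext h3, Fin.ext h4, Fin.ext h5]
  rw [edgeArray]
  refine (hinj.extend_apply _ _ (l, j, k, a, b)).trans ?_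
  simp [h]

open Classical in
theorem graphArray_apply (j k : Fin n) :
    graphArray Q ((j : ℕ) * n + k) = if Q.interactionGraph.Adj j k then 1 else 0 := by
  have hinj : Function.Injective fun q : Fin n × Fin n => (q.1 : ℕ) * n + q.2 := by
    rintro ⟨j, k⟩ ⟨j', k'⟩ h
    simp only [pair_inj k.2 k'.2] at h
    rw [Fin.ext h.1, Fin.ext h.2]
  exact hinj.extend_apply _ _ (j, k)

theorem graphArray_pos_iff (j k : Fin n) :
    0 < graphArray Q ((j : ℕ) * n + k) ↔ Q.interactionGraph.Adj j k := by
  classical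
  rw [graphArray_apply]
  split_ifs with h <;> simp [h]

theorem eventArray_apply (S : Finset (Fin n)) (z : S → Fin 2) (j : Fin n) :
    eventArray S z j = if h : j ∈ S then 1 + (z ⟨j, h⟩ : ℕ) else 0 :=
  (Fin.val_injective).extend_apply _ _ j

theorem graphArray_le (x : ℕ) : graphArray Q x ≤ 1 := by
  classical
  rw [graphArray, Function.extend_def]
  split_ifs <;> simp

theorem eventArray_le (S : Finset (Fin n)) (z : S → Fin 2) (x : ℕ) : eventArray S z x ≤ 2 := by
  classical
  rw [eventArray, Function.extend_def]
  split_ifs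
  · omega
  · simp
  · simp

/-! ## The marginal as a partition function -/

/-- The bit of the first history at time `l`. -/
def fwdBit (c l : ℕ) : Fin 2 := ⟨fwd c (4 ^ l), by unfold fwd; omega⟩

/-- The bit of the second history at time `l`. -/
def bwdBit (c l : ℕ) : Fin 2 := ⟨bwd c (4 ^ l), by unfold bwd; omega⟩

/-- The pair of histories encoded by a configuration. -/
def histories (σ : Fin n → Fin (4 ^ (p + 1))) :
    (Fin (p + 1) → Fin n → Fin 2) × (Fin (p + 1) → Fin n → Fin 2) :=
  (fun l j => fwdBit (σ j) l, fun l j => bwdBit (σ j) l)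

/-- The two bits at time `l` determine the base-`4` digit number `l` of each state, which gives
injectivity. Surjectivity follows by counting: `(4 ^ (p + 1)) ^ n` is the square of `(2 ^ n) ^ (p +
1)`. -/
theorem histories_bijective : Function.Bijective (histories (n := n) (p := p)) := by
  rw [Fintype.bijective_iff_injective_and_card]
  constructor
  · intro σ τ h
    funext j
    refine (finFunctionFinEquiv (m := 4) (n := p + 1)).symm.injective ?_
    funext l
    refine Fin.ext ?_
    have h1 : fwdBit (σ j) l = fwdBit (τ j) l := congrFun (congrFun (congrArg Prod.fst h) l) j
    have h2 : bwdBit (σ j) l = bwdBit (τ j) l := congrFun (congrFun (congrArg Prod.snd h) l) j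
    have h1 := congrArg Fin.val h1
    have h2 := congrArg Fin.val h2
    simp only [fwdBit, bwdBit, fwd, bwd] at h1 h2
    change (σ j : ℕ) / 4 ^ (l : ℕ) % 4 = (τ j : ℕ) / 4 ^ (l : ℕ) % 4
    omega
  · simp only [Fintype.card_prod, Fintype.card_pi, Fintype.card_fin, Finset.prod_const,
      Finset.card_univ]
    rw [← mul_pow, ← mul_pow, ← pow_mul, ← pow_mul, mul_comm n]
    norm_num

theorem violation_pos_iff (S : Finset (Fin n)) (z : S → Fin 2) (j : Fin n) (a b : Fin 2) :
    0 < violation (eventArray S z j) a b ↔ ¬ (a = b ∧ ∀ h : j ∈ S, a = z ⟨j, h⟩) := by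
  rw [eventArray_apply]
  by_cases h : j ∈ S
  · simp only [h, dif_pos, forall_true_left]
    generalize z ⟨j, h⟩ = c
    revert a b c
    decide
  · simp only [h, dif_neg, not_false_eq_true, IsEmpty.forall_iff, and_true]
    revert a b
    decide

/-- The initial interactions of an instance. -/
noncomputable def instanceTable (S : Finset (Fin n)) (z : S → Fin 2) : ℕ → ℕ → ℕ → ℕ → ℂ :=
  initTable n p (graphArray Q) (eventArray S z) (mixArray Q) (vertexArray Q) (edgeArray Q)

/-- Adjacency need not be assumed: for non-adjacent vertices the table holds `1`, and so do all the
corresponding gates. -/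
theorem instanceTable_edge (S : Finset (Fin n)) (z : S → Fin 2) {j k : Fin n} (h : j < k)
    (c d : ℕ) : instanceTable Q S z j k c d = ∏ l : Fin p,
      (Q.edgeGate l j k (fwdBit c l) (fwdBit d l) *
        (starRingEnd ℂ) (Q.edgeGate l j k (bwdBit c l) (bwdBit d l))) := by
  rw [instanceTable, initTable, if_pos (show (j : ℕ) < k from h)]
  by_cases ha : Q.interactionGraph.Adj j k
  · rw [if_pos ((graphArray_pos_iff Q j k).2 ha), Finset.prod_range]
    refine Finset.prod_congr rfl fun l _ => ?_
    rw [← edgeArray_apply Q ha, ← edgeArray_apply Q ha]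
    rfl
  · rw [if_neg (fun h => ha ((graphArray_pos_iff Q j k).1 h))]
    simp [Q.edgeGate_of_not_adj h.ne ha]

theorem instanceTable_vertex (S : Finset (Fin n)) (z : S → Fin 2) (j : Fin n) (c d : ℕ) :
    instanceTable Q S z j j c d =
      if ¬ (fwdBit c p = bwdBit c p ∧ ∀ h : j ∈ S, fwdBit c p = z ⟨j, h⟩) then 0 else
      (1 / 2) * ∏ l : Fin p,
      (Q.vertexGate l j (fwdBit c l) * Q.mixGate l (fwdBit c (l + 1)) (fwdBit c l) *
        (starRingEnd ℂ)
          (Q.vertexGate l j (bwdBit c l) * Q.mixGate l (bwdBit c (l + 1)) (bwdBit c l))) := by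
  rw [instanceTable, initTable, if_neg (lt_irrefl _)]
  refine if_congr (violation_pos_iff S z j (fwdBit c p) (bwdBit c p)) rfl ?_
  rw [Finset.prod_range]
  congr 1
  · norm_num
  · refine Finset.prod_congr rfl fun l _ => ?_
    rw [← vertexArray_apply, ← vertexArray_apply, ← mixArray_apply, ← mixArray_apply]
    rfl

theorem configWeight_eq_mul {D m : ℕ} (F : ℕ → ℕ → ℕ → ℕ → ℂ) (σ : Fin m → Fin D) :
    configWeight F σ = (∏ j : Fin m, F j j (σ j) (σ j)) *
      ∏ j : Fin m, ∏ k : Fin m, if j < k then F j k (σ j) (σ k) else 1 := by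
  have h : ∀ j k : Fin m, (if (j : ℕ) ≤ k then F j k (σ j) (σ k) else 1) =
      (if j = k then F j k (σ j) (σ k) else 1) * if j < k then F j k (σ j) (σ k) else 1 := by
    intro j k
    rcases lt_trichotomy j k with h | h | h
    · simp [h.ne, h, h.le]
    · simp [h]
    · simp [h.ne', h.not_gt, h.not_ge]
  simp only [configWeight, h, Finset.prod_mul_distrib, Finset.prod_ite_eq, Finset.mem_univ,
    if_true]

theorem prod_ite_not_zero {m : ℕ} (q : Fin m → Prop) [DecidablePred q] [Decidable (∀ j, q j)]
    (f : Fin m → ℂ) :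
    (∏ j, if ¬ q j then 0 else f j) = if ∀ j, q j then ∏ j, f j else 0 := by
  split_ifs with h
  · exact Finset.prod_congr rfl fun j _ => by rw [if_neg (not_not.2 (h j))]
  · push Not at h
    obtain ⟨j, hj⟩ := h
    exact Finset.prod_eq_zero (Finset.mem_univ j) (if_pos hj)

/-- The end condition is a conjunction of conditions on single qubits, so its indicator is a product
of vertex factors. The rest is an exchange of products over layers with products over vertices and
pairs. -/
theorem configWeight_instanceTable (S : Finset (Fin n)) (z : S → Fin 2)
    (σ : Fin n → Fin (4 ^ (p + 1))) :
    configWeight (instanceTable Q S z) σ =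
      if (histories σ).1 (Fin.last p) = (histories σ).2 (Fin.last p) ∧
          ∀ j : S, (histories σ).1 (Fin.last p) j = z j then
        Q.histWeight (histories σ).1 * (starRingEnd ℂ) (Q.histWeight (histories σ).2) else 0 := by
  classical
  have hedge : ∀ j k : Fin n,
      (if j < k then instanceTable Q S z j k (σ j) (σ k) else 1) = ∏ l : Fin p,
      ((if j < k then Q.edgeGate l j k (fwdBit (σ j) l) (fwdBit (σ k) l) else 1) *
        (starRingEnd ℂ)
          (if j < k then Q.edgeGate l j k (bwdBit (σ j) l) (bwdBit (σ k) l) else 1)) := by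
    intro j k
    split_ifs with h
    · exact instanceTable_edge Q S z h _ _
    · simp
  -- The initial state contributes `1 / √2` per qubit in each history, hence the factor `1 / 2` in
  -- every vertex weight.
  have hhalf : ∀ x x', Instance.plusState n x * (starRingEnd ℂ) (Instance.plusState n x') =
      ∏ _j : Fin n, (1 / 2 : ℂ) := by
    intro x x'
    rw [Instance.plusState, Instance.plusState, map_prod, ← Finset.prod_mul_distrib]
    refine Finset.prod_congr rfl fun _ _ => ?_
    rw [map_div₀, Complex.conj_ofReal, map_one, div_mul_div_comm, ← Complex.ofReal_mul,
      Real.mul_self_sqrt (by norm_num)]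
    norm_num
  rw [configWeight_eq_mul]
  simp only [instanceTable_vertex, hedge]
  rw [prod_ite_not_zero, ite_mul, zero_mul]
  refine if_congr ?_ ?_ rfl
  · constructor
    · intro h
      exact ⟨funext fun j => (h j).1, fun j => (h j).2 j.2⟩
    · intro h j
      exact ⟨congrFun h.1 j, fun hj => h.2 ⟨j, hj⟩⟩
  · have hlayer : ∀ l : Fin p,
        ((∏ j, Q.mixGate l ((histories σ).1 l.succ j) ((histories σ).1 l.castSucc j)) *
          (Q.globalPhase l * Q.phaseProd l ((histories σ).1 l.castSucc))) *
        (starRingEnd ℂ)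
        ((∏ j, Q.mixGate l ((histories σ).2 l.succ j) ((histories σ).2 l.castSucc j)) *
          (Q.globalPhase l * Q.phaseProd l ((histories σ).2 l.castSucc))) =
        (∏ j : Fin n, (Q.vertexGate l j (fwdBit (σ j) l) *
            Q.mixGate l (fwdBit (σ j) (l + 1)) (fwdBit (σ j) l) *
          (starRingEnd ℂ) (Q.vertexGate l j (bwdBit (σ j) l) *
            Q.mixGate l (bwdBit (σ j) (l + 1)) (bwdBit (σ j) l)))) *
        ∏ j : Fin n, ∏ k : Fin n,
          ((if j < k then Q.edgeGate l j k (fwdBit (σ j) l) (fwdBit (σ k) l) else 1) *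
          (starRingEnd ℂ)
            (if j < k then Q.edgeGate l j k (bwdBit (σ j) l) (bwdBit (σ k) l) else 1)) := by
      intro l
      have hg := Q.globalPhase_mul_conj l
      simp only [Instance.phaseProd, histories, Fin.val_succ, Fin.val_castSucc, map_mul, map_prod,
        Finset.prod_mul_distrib]
      -- Here `g` and `g'` are the global phase and its conjugate, which cancel.
      have key : ∀ a b c a' b' c' g g' : ℂ, g * g' = 1 →
          a * (g * (b * c)) * (a' * (g' * (b' * c'))) = b * a * (b' * a') * (c * c') := by
        intro a b c a' b' c' g g' h
        linear_combination (a * b * c * a' * b' * c') * h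
      exact key _ _ _ _ _ _ _ _ hg
    have hl := Finset.prod_congr (rfl : (Finset.univ : Finset (Fin p)) = Finset.univ)
      fun l _ => hlayer l
    rw [Finset.prod_mul_distrib] at hl
    have hswap : ∀ a b c d : ℂ, a * b * (c * d) = a * c * (b * d) := fun a b c d => by ring
    rw [Instance.histWeight, Instance.histWeight, map_mul, map_prod, hswap, hhalf, hl,
      Finset.prod_mul_distrib, Finset.prod_mul_distrib, mul_assoc]
    congr 2
    · exact Finset.prod_comm
    · exact (Finset.prod_congr rfl fun j _ => Finset.prod_comm).trans Finset.prod_comm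

theorem marginal_eq_partition (S : Finset (Fin n)) (z : S → Fin 2) :
    (Q.marginal S z : ℂ) = partition (4 ^ (p + 1)) n (instanceTable Q S z) := by
  rw [Q.marginal_eq, partition, ← Fintype.sum_prod_type', ← histories_bijective.sum_comp]
  exact Finset.sum_congr rfl fun σ _ => (configWeight_instanceTable Q S z σ).symm

theorem eliminable_instanceTable (hQ : Q.interactionDegree ≤ 2) (S : Finset (Fin n))
    (z : S → Fin 2) :
    Eliminable (4 ^ (p + 1)) n (readAdj n (graphArray Q)) (instanceTable Q S z) := by
  classical
  refine ⟨fun j k c d hjk hk h0 _ _ => ?_, fun x hx => ?_⟩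
  · rw [readAdj] at h0
    simp [instanceTable, initTable, hjk, h0]
  · have hsub : nbrs (readAdj n (graphArray Q)) n x ⊆
        (Q.interactionGraph.neighborFinset ⟨x, hx⟩).image Fin.val := by
      intro k hk
      obtain ⟨hkn, h⟩ := mem_nbrs.1 hk
      refine Finset.mem_image.2 ⟨⟨k, hkn⟩, ?_, rfl⟩
      rw [SimpleGraph.mem_neighborFinset]
      rcases h with ⟨-, h⟩ | ⟨-, h⟩
      · exact ((graphArray_pos_iff Q ⟨k, hkn⟩ ⟨x, hx⟩).1 h).symm
      · exact (graphArray_pos_iff Q ⟨x, hx⟩ ⟨k, hkn⟩).1 h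
    refine (Finset.card_le_card hsub).trans (Finset.card_image_le.trans ?_)
    rw [SimpleGraph.card_neighborFinset_eq_degree]
    refine le_trans ?_ hQ
    rw [Instance.interactionDegree]
    convert Q.interactionGraph.degree_le_maxDegree ⟨x, hx⟩

/-! ### Size of the input and the final time bound -/

theorem inputMemory_bdd (S : Finset (Fin n)) (z : S → Fin 2) {B : ℕ} (hB : 2 ≤ B) (hn : n ≤ B)
    (hp : p ≤ B) : (inputMemory Q S z).Bdd B := by
  constructor
  · intro x
    match x with
    | 0 => exact hn
    | 1 => exact hp
    | _ + 2 => exact Nat.zero_le _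
  · intro A i
    match A with
    | 0 => exact (graphArray_le Q i).trans (by omega)
    | 1 => exact (eventArray_le S z i).trans hB
    | _ + 2 => exact Nat.zero_le _

/-- The constant `8` comes from `16 ^ (p + 1) = 2 ^ (4 * (p + 1)) ≤ 2 ^ (8 * p)`, valid for `p ≥ 1`,
together with `2 ≤ e`. For `n ^ 2 ≤ (n * p) ^ 8` it is generous, but one constant then serves in
both places. -/
theorem pow_bound_le_exp (hn : 0 < n) (hp : 0 < p) (k : ℕ) :
    (((n * n * (4 ^ (p + 1) * 4 ^ (p + 1)) : ℕ) ^ k : ℕ) : ℝ) ≤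
      ((n : ℝ) * (p : ℝ)) ^ (8 * k) * Real.exp (((8 * k : ℕ) : ℝ) * (p : ℝ)) := by
  have hn' : (1 : ℝ) ≤ n := by exact_mod_cast hn
  have hp' : (1 : ℝ) ≤ p := by exact_mod_cast hp
  have h1 : (1 : ℝ) ≤ (n : ℝ) * p := by nlinarith
  have hexp : Real.exp (((8 * k : ℕ) : ℝ) * (p : ℝ)) = (Real.exp 1 ^ (8 * p)) ^ k := by
    rw [← pow_mul, ← Real.exp_nat_mul]
    congr 1
    push_cast
    ring
  rw [hexp, pow_mul ((n : ℝ) * p), ← mul_pow (((n : ℝ) * p) ^ 8), Nat.cast_pow]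
  refine pow_le_pow_left₀ (Nat.cast_nonneg _) ?_ k
  push_cast
  refine mul_le_mul ?_ ?_ (by positivity) (by positivity)
  · calc (n : ℝ) * n ≤ (n * p) * (n * p) := by
          have : (n : ℝ) ≤ n * p := by nlinarith
          exact mul_le_mul this this (by positivity) (by positivity)
      _ = ((n : ℝ) * p) ^ 2 := by ring
      _ ≤ ((n : ℝ) * p) ^ 8 := pow_le_pow_right₀ h1 (by norm_num)
  · have h2 : (2 : ℝ) ≤ Real.exp 1 := by
      have := Real.add_one_le_exp (1 : ℝ)
      linarith
    calc (4 : ℝ) ^ (p + 1) * 4 ^ (p + 1) = 2 ^ (4 * (p + 1)) := by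
          rw [← mul_pow, pow_mul]; norm_num
      _ ≤ 2 ^ (8 * p) := pow_le_pow_right₀ (by norm_num) (by omega)
      _ ≤ Real.exp 1 ^ (8 * p) := pow_le_pow_left₀ (by norm_num) h2 _

end QAOASim

theorem theorem4p3 :
    ∃ (P : QAOASim.Prog) (K : ℕ),
      ∀ (n p : ℕ), 0 < n → 0 < p →
      ∀ (Q : QAOASim.Instance n p), Q.interactionDegree ≤ 2 →
      ∀ (S : Finset (Fin n)) (z : S → Fin 2),
        ∃ (t : ℕ) (s : QAOASim.Memory),
          QAOASim.Run P (QAOASim.inputMemory Q S z) t s ∧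
          QAOASim.output s = (Q.marginal S z : ℂ) ∧
          (t : ℝ) ≤ ((n : ℝ) * (p : ℝ)) ^ K * Real.exp ((K : ℝ) * (p : ℝ)) := by
  open QAOASim in
  refine ⟨simulationProg, 8 * simulationProg.deg, fun n p hn hp Q hQ S z => ?_⟩
  have hD : p + 1 < 4 ^ (p + 1) := Nat.lt_pow_self (by norm_num)
  have hDD : 4 ^ (p + 1) ≤ 4 ^ (p + 1) * 4 ^ (p + 1) := Nat.le_mul_self _
  have hB1 : 4 ^ (p + 1) * 4 ^ (p + 1) ≤ n * n * (4 ^ (p + 1) * 4 ^ (p + 1)) :=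
    Nat.le_mul_of_pos_left _ (by positivity)
  have hB2 : n ≤ n * n * (4 ^ (p + 1) * 4 ^ (p + 1)) :=
    (Nat.le_mul_self n).trans (Nat.le_mul_of_pos_right _ (by positivity))
  -- `B` is the number of table cells, the length of the longest loop; it also bounds `n`, `p` and
  -- the initial memory.
  obtain ⟨t, s, hr, ht, -, hout⟩ := wp_simulation (B := n * n * (4 ^ (p + 1) * 4 ^ (p + 1)))
    (s := inputMemory Q S z) (by omega) (inputMemory_bdd Q S z (by omega) hB2 (by omega)) hn rfl
    rfl rfl rfl rfl rfl rfl rfl le_rfl (eliminable_instanceTable Q hQ S z)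
  refine ⟨t, s, hr, hout.trans (marginal_eq_partition Q S z).symm, ?_⟩
  exact (Nat.cast_le.2 ht.2).trans (pow_bound_le_exp hn hp _)
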